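/- Let $K$ be any field, let $n\ge 1$, and let $R=K[x_0,\dots,x_n]$ with its standard grading. For a finite set $Z\subset\mathbb P^n$ of ($K$-rational) points and $k\ge 1$, let $I_Z^{(k)}=\bigcap_{P\in Z} I_P^k\subset R$ be the ideal of polynomials vanishing to order at least $k$ at every point of $Z$, where $I_P$ is the homogeneous ideal of $P$. Let $\alpha(I)$ be the least degree of a nonzero form in a nonzero homogeneous ideal $I$, and let $\widehat\alpha(I_Z)=\lim_{k\to\infty}\alpha(I_Z^{(k)})/k$ be the Waldschmidt constant. The set $Z$ is in linearly general position if any $r+1\le n+1$ points of $Z$ span a linear subspace of dimension $r$. Suppose that $Z$ spans $\mathbb P^n$, that $|Z|\le n+3$, and that, if $|Z|=n+3$, then $Z$ is in linearly general position. Then the limit $\widehat\alpha(I_Z)$ exists, and Demailly's inequality \[ \widehat\alpha(I_Z)\ \ge\ \frac{\alpha(I_Z^{(k)})+n-1}{n+k-1} \] holds for every integer $k\ge 1$, unless $|Z|=n+3$ and $n$ is odd. If $|Z|=n+3$ and $n$ is odd, it holds for every integer $k\ge 1$ with \[ k\ \ge\ \frac{(n^2+n+1)(n^2+2n-1)}{2(n+2)}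 . \] -/

import Mathlib

open Filter Topology
open scoped LinearAlgebra.Projectivization

namespace FatPoints

variable {K : Type*} [Field K] {n : ℕ}

/-- The `(n+1)`-dimensional coordinate vector space whose lines are the `K`-rational points of
projective `n`-space `ℙ K (Fin (n + 1) → K)`; this is the linear subspace of it that corresponds
to the linear span of a finite set of points. -/
def linearSpan (Z : Finset (ℙ K (Fin (n + 1) → K))) : Submodule K (Fin (n + 1) → K) :=
  ⨆ P ∈ Z, P.submodule

/-- `Z` is in linearly general position: any `r + 1 ≤ n + 1` points of `Z` span a linear subspace
of projective dimension `r`, that is, of vector space dimension `r + 1`. -/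
def LinearlyGeneral (Z : Finset (ℙ K (Fin (n + 1) → K))) : Prop :=
  ∀ S : Finset (ℙ K (Fin (n + 1) → K)), S ⊆ Z → S.card ≤ n + 1 →
    Module.finrank K (linearSpan S) = S.card

/-- The homogeneous ideal `I_P ⊆ K[x₀, …, xₙ]` of a point `P`: it is generated by the forms that
vanish at `P`. (Whether a form vanishes does not depend on the coordinate vector of `P`.) -/
noncomputable def pointIdeal (P : ℙ K (Fin (n + 1) → K)) : Ideal (MvPolynomial (Fin (n + 1)) K) :=
  Ideal.span {f | (∃ d : ℕ, f.IsHomogeneous d) ∧ MvPolynomial.eval P.rep f = 0}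

/-- The symbolic power `I_Z^{(k)}` of the ideal `I_Z` of a finite set of points `Z`: the ideal of
polynomials that vanish to order at least `k` at every point of `Z`, i.e. `⋂_{P ∈ Z} I_P ^ k`.
For `k = 1` this is the ideal `I_Z` itself. -/
noncomputable def symbolicPower (Z : Finset (ℙ K (Fin (n + 1) → K))) (k : ℕ) :
    Ideal (MvPolynomial (Fin (n + 1)) K) :=
  ⨅ P ∈ Z, pointIdeal P ^ k

/-- The initial degree of a nonzero homogeneous ideal: the least degree of a nonzero form in it. -/
noncomputable def initialDegree (I : Ideal (MvPolynomial (Fin (n + 1)) K)) : ℕ :=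
  sInf {j : ℕ | ∃ f ∈ I, f ≠ 0 ∧ f.IsHomogeneous j}

/-- The Waldschmidt constant of the ideal of `Z`, the limit of `α(I_Z^{(k)}) / k` for `k → ∞`.
(That this limit exists is asserted separately where the constant is used.) -/
noncomputable def waldschmidtConstant (Z : Finset (ℙ K (Fin (n + 1) → K))) : ℝ :=
  limUnder atTop (fun k : ℕ => (initialDegree (symbolicPower Z k) : ℝ) / k)

end FatPoints

/-! Demailly's inequality follows from two matching estimates with common constants `a`, `b`. If
every nonzero form of degree `d` with multiplicity `k` along `Z` has `(a + b) * k ≤ b * d`, the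
Waldschmidt constant is at least `1 + a / b`. If some such form has degree `k + a * (k + n - 1) / b`
(rounded down), then `α + n - 1 ≤ (1 + a / b) * (k + n - 1)`. Together these give the inequality
(`demailly_of_bounds`), and subadditivity of `α` gives the limit.

Lower bounds. Take `n + 1` of the points as coordinate points. Multiplicity `k` there bounds every
exponent by `d - k`, so the coordinates in the support of a further point can be inverted; the
Cremona transform still has multiplicity `k` at the image of that point, so its degree is at least
`k` (`add_le_of_mem_coordinate_of_mem`). This is sharp for at most `n + 2` points and for `n + 3`
points with `n` even. For `n + 3` points and `n` odd, inverting all coordinates turns the rational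
normal curve through the points into a line through two points of multiplicity `k`, which bounds
below the multiplicity `μ` along the curve. The spans of `T = (n + 1) / 2` points of the curve fill
the space, so the form is nonzero on some span, and there `d ≤ T * (d - μ)` (`secant_bound`).

Upper bounds. The forms are products of hyperplanes and of determinants of Hankel matrices, which
define secant varieties of the rational normal curve (`n` even) or cones over them (`n` odd). Such a
determinant has degree `m + 1` and multiplicity `m` at the points, `m + 1` at the vertex of the
cone. Arranging the points cyclically and letting successive factors be deficient on successive
windows spreads the defect of multiplicity evenly (`hasForm_of_basis`, `hasForm_of_curve`). -/

namespace FatPoints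
open MvPolynomial
universe u

/-! ### Order of vanishing at a point of affine space. -/

section Order
variable {σ K : Type*} [CommRing K]

/-- The ideal of polynomials vanishing at the point `p` of affine space. -/
noncomputable def maxIdeal (p : σ → K) : Ideal (MvPolynomial σ K) :=
  Ideal.span (Set.range fun i => X i - C (p i))

/-- All later transfers of multiplicity (translation, linear substitution, inversion) are instances
of this: a substitution congruent to `p` modulo `J` carries the ideal of `p` into `J`. -/
lemma aeval_mem_pow {R : Type*} [CommRing R] [Algebra K R] {p : σ → K} {z : σ → R} {J : Ideal R}
    (h : ∀ i, z i - algebraMap K R (p i) ∈ J) {f : MvPolynomial σ K} {k : ℕ}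
    (hf : f ∈ maxIdeal p ^ k) : aeval z f ∈ J ^ k := by
  have h1 : (maxIdeal p).map (aeval z : MvPolynomial σ K →ₐ[K] R) ≤ J := by
    rw [maxIdeal, Ideal.map_span, Ideal.span_le]
    rintro _ ⟨_, ⟨i, rfl⟩, rfl⟩
    simpa using h i
  have h2 := Ideal.mem_map_of_mem (aeval z : MvPolynomial σ K →ₐ[K] R) hf
  rw [Ideal.map_pow] at h2
  exact Ideal.pow_right_mono h1 k h2

lemma map_mem_maxIdeal_pow {L : Type*} [CommRing L] (φ : K →+* L) {p : σ → K}
    {f : MvPolynomial σ K} {k : ℕ} (hf : f ∈ maxIdeal p ^ k) :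
    map φ f ∈ maxIdeal (fun i => φ (p i)) ^ k := by
  have h1 : (maxIdeal p).map (map φ : MvPolynomial σ K →+* MvPolynomial σ L) ≤
      maxIdeal (fun i => φ (p i)) := by
    rw [maxIdeal, Ideal.map_span, Ideal.span_le]
    rintro _ ⟨_, ⟨i, rfl⟩, rfl⟩
    exact Ideal.subset_span ⟨i, by simp⟩
  have h2 := Ideal.mem_map_of_mem (map φ : MvPolynomial σ K →+* MvPolynomial σ L) hf
  rw [Ideal.map_pow] at h2
  exact Ideal.pow_right_mono h1 k h2

lemma sub_C_eval_mem_maxIdeal (p : σ → K) (f : MvPolynomial σ K) :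
    f - C (eval p f) ∈ maxIdeal p := by
  induction f using MvPolynomial.induction_on with
  | C a => simp
  | add f g hf hg => simpa [add_sub_add_comm] using add_mem hf hg
  | mul_X f i hf =>
    have : f * X i - C (eval p (f * X i)) =
        f * (X i - C (p i)) + C (p i) * (f - C (eval p f)) := by
      simp; ring
    rw [this]
    exact add_mem (Ideal.mul_mem_left _ _ (Ideal.subset_span ⟨i, rfl⟩))
      (Ideal.mul_mem_left _ _ hf)

lemma mem_maxIdeal_iff {p : σ → K} {f : MvPolynomial σ K} :
    f ∈ maxIdeal p ↔ eval p f = 0 := by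
  constructor
  · intro h
    have h1 : f ∈ maxIdeal p ^ 1 := by simpa using h
    have := aeval_mem_pow (R := K) (J := ⊥) (z := p) (by simp) h1
    simpa [aeval_eq_eval] using this
  · intro h
    simpa [h] using sub_C_eval_mem_maxIdeal p f

lemma totalDegree_aeval_le {τ L : Type*} [CommRing L] [Algebra K L] {z : σ → MvPolynomial τ L}
    (hz : ∀ i, (z i).totalDegree ≤ 1) (f : MvPolynomial σ K) :
    (aeval z f).totalDegree ≤ f.totalDegree := by
  rw [aeval_def, eval₂_eq]
  refine totalDegree_finsetSum_le fun a ha => ?_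
  refine (totalDegree_mul _ _).trans ?_
  have h0 : (algebraMap K (MvPolynomial τ L) (coeff a f)).totalDegree = 0 := by
    rw [MvPolynomial.algebraMap_apply, totalDegree_C]
  rw [h0, zero_add]
  refine (totalDegree_finsetProd _ _).trans ?_
  refine le_trans (Finset.sum_le_sum fun i _ => (totalDegree_pow _ _).trans
    (Nat.mul_le_mul_left (a i) (hz i))) ?_
  simpa [Finsupp.sum] using le_totalDegree ha

/-- Translating `p` to the origin does not raise the degree, and a nonzero polynomial of order at
least `k` at the origin has a monomial of degree at least `k`. -/
lemma le_totalDegree_of_mem [Nontrivial K] {p : σ → K} {f : MvPolynomial σ K} {k : ℕ}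
    (hf : f ∈ maxIdeal p ^ k) (h0 : f ≠ 0) : k ≤ f.totalDegree := by
  set F := aeval (fun i => X i + C (p i) : σ → MvPolynomial σ K) f with hF
  have hF0 : F ≠ 0 := by
    intro h
    apply h0
    have := congrArg (aeval (fun i => X i - C (p i) : σ → MvPolynomial σ K)) h
    rw [hF, ← AlgHom.comp_apply] at this
    have e : (aeval (fun i => X i - C (p i) : σ → MvPolynomial σ K)).comp
        (aeval (fun i => X i + C (p i) : σ → MvPolynomial σ K)) = AlgHom.id K _ := by
      ext1 i; simp [MvPolynomial.algebraMap_eq]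
    rw [e] at this
    simpa using this
  have hm : F ∈ idealOfVars σ K ^ k := aeval_mem_pow (fun i => by
    rw [MvPolynomial.algebraMap_eq, add_sub_cancel_right]
    exact Ideal.subset_span ⟨i, rfl⟩) hf
  obtain ⟨a, ha⟩ := Finset.nonempty_of_ne_empty (mt support_eq_empty.mp hF0)
  have h1 := (mem_pow_idealOfVars_iff k F).1 hm a ha
  have h2 : F.totalDegree ≤ f.totalDegree := totalDegree_aeval_le (fun i => by
    refine (totalDegree_add _ _).trans ?_
    simp [totalDegree_X]) f
  exact (h1.trans (le_totalDegree ha)).trans h2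

end Order

/-! ### Linear substitutions and bounds on exponents. -/

section Homogeneous
variable {σ ι K L : Type*} [CommRing K] [CommRing L]

lemma degree_eq_of_mem_support {f : MvPolynomial σ K} {d : ℕ} (hf : f.IsHomogeneous d)
    {a : σ →₀ ℕ} (ha : a ∈ f.support) : a.degree = d := by
  have := hf (mem_support_iff.1 ha)
  rw [Finsupp.degree_eq_weight_one]
  exact this

/-- The substitution `x ↦ ∑ j, X j • p j` for vectors `p j`. -/
noncomputable def combine [Fintype ι] (p : ι → σ → K) (f : MvPolynomial σ K) : MvPolynomial ι K :=
  aeval (fun i => ∑ j, C (p j i) * X j) f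

lemma combine_isHomogeneous [Fintype ι] (p : ι → σ → K) {f : MvPolynomial σ K} {d : ℕ}
    (hf : f.IsHomogeneous d) : (combine p f).IsHomogeneous d := by
  have := hf.aeval (fun i => ∑ j, C (p j i) * X j) (n := 1) (fun i =>
    IsHomogeneous.sum _ _ _ fun j _ => by
      simpa using (isHomogeneous_C ι (p j i)).mul (isHomogeneous_X K j))
  simpa [combine] using this

lemma aeval_combine [Fintype ι] {R : Type*} [CommRing R] [Algebra K R] (p : ι → σ → K)
    (f : MvPolynomial σ K) (z : ι → R) :
    aeval z (combine p f) = aeval (fun i => ∑ j, algebraMap K R (p j i) * z j) f := by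
  rw [combine, ← AlgHom.comp_apply]
  congr 1
  ext i
  simp

/-- Setting `X j = 1` moves `p j` to the origin of an affine chart, so each monomial has degree at
least `k` in the other variables. The vectors `p j` need not be independent. -/
theorem add_le_of_mem_support_combine [Fintype ι] {p : ι → σ → K} {f : MvPolynomial σ K} {d k : ℕ}
    (hf : f.IsHomogeneous d) {j : ι} (hj : f ∈ maxIdeal (p j) ^ k)
    {a : ι →₀ ℕ} (ha : a ∈ (combine p f).support) : a j + k ≤ d := by
  classical
  set F := combine p f with hF
  have hhom : F.IsHomogeneous d := combine_isHomogeneous p hf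
  let z : ι → MvPolynomial ι K := fun i => if i = j then 1 else X i
  have hz : aeval z F ∈ idealOfVars ι K ^ k := by
    rw [hF, aeval_combine]
    refine aeval_mem_pow (fun i => ?_) hj
    rw [← Finset.add_sum_erase _ _ (Finset.mem_univ j)]
    simp only [z, if_true, mul_one, add_sub_cancel_left]
    refine Ideal.sum_mem _ fun i' hi' => Ideal.mul_mem_left _ _ ?_
    rw [if_neg (Finset.ne_of_mem_erase hi')]
    exact Ideal.subset_span ⟨i', rfl⟩
  have hzF : aeval z F = ∑ b ∈ F.support, monomial (b.erase j) (coeff b F) := by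
    rw [aeval_def, eval₂_eq']
    refine Finset.sum_congr rfl fun b _ => ?_
    rw [monomial_eq, MvPolynomial.algebraMap_eq, Finsupp.prod_fintype _ _ (by simp)]
    congr 1
    refine Finset.prod_congr rfl fun i _ => ?_
    by_cases h : i = j
    · simp [z, h]
    · simp [z, h, Finsupp.erase_ne]
  have hdeg : ∀ b ∈ F.support, b.degree = d := fun b hb => degree_eq_of_mem_support hhom hb
  have herase : ∀ b : ι →₀ ℕ, b.degree = b j + (b.erase j).degree := fun b => by
    conv_lhs => rw [← Finsupp.single_add_erase j b]
    simp [map_add]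
  -- No cancellation occurs: among monomials of degree `d`, the exponents away from `j` determine
  -- the exponent at `j`.
  have hc : coeff (a.erase j) (aeval z F) = coeff a F := by
    rw [hzF, coeff_sum, Finset.sum_eq_single a]
    · simp
    · intro b hb hba
      rw [coeff_monomial, if_neg]
      intro h
      apply hba
      have h1 := herase b
      have h2 := herase a
      rw [hdeg b hb] at h1
      rw [hdeg a ha, ← h] at h2
      rw [← Finsupp.single_add_erase j b, ← Finsupp.single_add_erase j a, h]
      congr 2
      omega
    · exact fun h => absurd ha h
  have h3 := (mem_pow_idealOfVars_iff k _).1 hz (a.erase j)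
    (by rw [mem_support_iff, hc]; exact mem_support_iff.1 ha)
  have := herase a
  rw [hdeg a ha] at this
  omega

lemma combine_single [Fintype σ] [DecidableEq σ] (f : MvPolynomial σ K) :
    combine (fun j : σ => Pi.single j 1) f = f := by
  rw [combine]
  conv_rhs => rw [← aeval_X_left_apply (R := K) f]
  congr 2
  ext i : 1
  rw [Finset.sum_eq_single i] <;> simp +contextual [eq_comm]

end Homogeneous

/-! ### Cremona transformations and the first degree bound. -/

section Cremona
variable {σ K : Type*} [Fintype σ] [DecidableEq σ] [Field K]

/-- The effect of the Cremona transformation in the variables `S` on exponents. -/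
noncomputable def flip (e : ℕ) (S : Finset σ) (a : σ →₀ ℕ) : σ →₀ ℕ :=
  Finsupp.equivFunOnFinite.symm fun i => if i ∈ S then e - a i else a i

lemma flip_apply (e : ℕ) (S : Finset σ) (a : σ →₀ ℕ) (i : σ) :
    flip e S a i = if i ∈ S then e - a i else a i := rfl

lemma flip_flip {e : ℕ} {S : Finset σ} {a : σ →₀ ℕ} (h : ∀ i ∈ S, a i ≤ e) :
    flip e S (flip e S a) = a := by
  ext i
  by_cases hi : i ∈ S
  · have := h i hi
    simp only [flip_apply, hi, if_true]; omega
  · simp [flip_apply, hi]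

/-- The polynomial `∏ i ∈ S, x i ^ e * f (x')`, where `x'` is obtained from `x` by inverting the
coordinates in `S`. -/
noncomputable def cremona (e : ℕ) (S : Finset σ) (f : MvPolynomial σ K) : MvPolynomial σ K :=
  ∑ a ∈ f.support, monomial (flip e S a) (coeff a f)

/-- Inversion of the coordinates in `S`. -/
def invOn (S : Finset σ) (q : σ → K) (i : σ) : K := if i ∈ S then (q i)⁻¹ else q i

variable {e : ℕ} {S : Finset σ} {f : MvPolynomial σ K}

lemma coeff_flip_cremona (h : ∀ a ∈ f.support, ∀ i ∈ S, a i ≤ e) {a : σ →₀ ℕ}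
    (ha : a ∈ f.support) : coeff (flip e S a) (cremona e S f) = coeff a f := by
  rw [cremona, coeff_sum, Finset.sum_eq_single a]
  · simp
  · intro b hb hba
    rw [coeff_monomial, if_neg]
    intro hab
    apply hba
    rw [← flip_flip (h b hb), hab, flip_flip (h a ha)]
  · exact fun h => absurd ha h

lemma exists_of_mem_support_cremona {b : σ →₀ ℕ} (hb : b ∈ (cremona e S f).support) :
    ∃ a ∈ f.support, b = flip e S a := by
  rw [mem_support_iff, cremona, coeff_sum] at hb
  obtain ⟨a, ha, hab⟩ := Finset.exists_ne_zero_of_sum_ne_zero hb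
  rw [coeff_monomial] at hab
  exact ⟨a, ha, by by_contra h; exact hab (if_neg (Ne.symm h))⟩

lemma support_cremona_le {b : σ →₀ ℕ} (hb : b ∈ (cremona e S f).support) : ∀ i ∈ S, b i ≤ e := by
  obtain ⟨a, -, rfl⟩ := exists_of_mem_support_cremona hb
  intro i hi
  simp [flip_apply, hi]

lemma cremona_cremona (h : ∀ a ∈ f.support, ∀ i ∈ S, a i ≤ e) :
    cremona e S (cremona e S f) = f := by
  ext a
  by_cases ha : a ∈ f.support
  · have h1 := coeff_flip_cremona h ha
    have h2 : flip e S a ∈ (cremona e S f).support := by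
      rw [mem_support_iff, h1]; exact mem_support_iff.1 ha
    have h3 := coeff_flip_cremona (fun b hb => support_cremona_le hb) h2
    rwa [flip_flip (h a ha), h1] at h3
  · rw [notMem_support_iff.1 ha]
    by_contra hne
    obtain ⟨b, hb, rfl⟩ := exists_of_mem_support_cremona (mem_support_iff.2 hne)
    obtain ⟨c, hc, rfl⟩ := exists_of_mem_support_cremona hb
    rw [flip_flip (h c hc)] at ha
    exact ha hc

lemma cremona_ne_zero (h : ∀ a ∈ f.support, ∀ i ∈ S, a i ≤ e) (hf : f ≠ 0) :
    cremona e S f ≠ 0 := by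
  intro h0
  apply hf
  rw [← cremona_cremona h, h0]
  simp [cremona]

/-- Modulo `m ^ k` the variables in `S` are units, being nonzero constants plus nilpotents.
Substituting their inverses, which are congruent to `q`, therefore makes sense and kills `f`; the
transform is that value times a monomial. -/
lemma cremona_mem_maxIdeal_pow (h : ∀ a ∈ f.support, ∀ i ∈ S, a i ≤ e) {q : σ → K}
    (hq : ∀ i ∈ S, q i ≠ 0) {k : ℕ} (hf : f ∈ maxIdeal q ^ k) :
    cremona e S f ∈ maxIdeal (invOn S q) ^ k := by
  set m := maxIdeal (invOn S q)
  let R := MvPolynomial σ K ⧸ m ^ k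
  let x : σ → R := fun i => Ideal.Quotient.mk (m ^ k) (X i)
  let J : Ideal R := m.map (Ideal.Quotient.mk (m ^ k))
  have hJ : J ^ k = ⊥ := by
    rw [← Ideal.map_pow, Ideal.map_quotient_self]
  have hx : ∀ i, x i - algebraMap K R (invOn S q i) ∈ J := fun i =>
    Ideal.mem_map_of_mem (Ideal.Quotient.mk (m ^ k)) (Ideal.subset_span ⟨i, rfl⟩)
  have hinv : ∀ i, ∃ y : R, if i ∈ S then x i * y = 1 else y = x i := by
    intro i
    by_cases hi : i ∈ S
    · simp only [hi, if_true]
      have hnil : IsNilpotent (x i - algebraMap K R (invOn S q i)) :=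
        ⟨k, by simpa [hJ] using Ideal.pow_mem_pow (hx i) k⟩
      have hu : IsUnit (algebraMap K R (invOn S q i)) := by
        refine IsUnit.map _ (IsUnit.mk0 _ ?_)
        simpa [invOn, hi] using hq i hi
      have := hnil.isUnit_add_left_of_commute hu (Commute.all _ _)
      rw [add_sub_cancel] at this
      exact isUnit_iff_exists_inv.1 this
    · simp [hi]
  choose y hy using hinv
  have hyq : ∀ i, y i - algebraMap K R (q i) ∈ J := by
    intro i
    have h1 := hx i
    have h2 := hy i
    by_cases hi : i ∈ S
    · simp only [hi, if_true, invOn] at h1 h2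
      have h3 : algebraMap K R (q i) * algebraMap K R (q i)⁻¹ = 1 := by
        rw [← map_mul, mul_inv_cancel₀ (hq i hi), map_one]
      have : y i - algebraMap K R (q i) =
          -(y i * algebraMap K R (q i)) * (x i - algebraMap K R (q i)⁻¹) := by
        linear_combination (algebraMap K R (q i)) * h2 - y i * h3
      rw [this]
      exact Ideal.mul_mem_left _ _ h1
    · simp only [hi, if_false, invOn] at h1 h2
      rwa [h2]
  have hfy : aeval y f = 0 := by
    have := aeval_mem_pow hyq hf
    rwa [hJ, Ideal.mem_bot] at this
  rw [← Ideal.Quotient.eq_zero_iff_mem]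
  have key : Ideal.Quotient.mk (m ^ k) (cremona e S f) = (∏ i ∈ S, x i ^ e) * aeval y f := by
    rw [aeval_def, eval₂_eq', Finset.mul_sum, cremona, map_sum]
    refine Finset.sum_congr rfl fun a ha => ?_
    rw [monomial_eq, map_mul, Finsupp.prod_fintype _ _ (by simp), map_prod, mul_left_comm]
    congr 1
    rw [← Finset.prod_mul_prod_compl S, ← Finset.prod_mul_prod_compl S, ← mul_assoc,
      ← Finset.prod_mul_distrib]
    congr 1
    · refine Finset.prod_congr rfl fun i hi => ?_
      have h1 := hy i
      have h2 := h a ha i hi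
      simp only [hi, if_true] at h1
      rw [flip_apply, if_pos hi, map_pow]
      change x i ^ (e - a i) = _
      obtain ⟨c, rfl⟩ := Nat.exists_eq_add_of_le' h2
      rw [Nat.add_sub_cancel, pow_add, mul_assoc, ← mul_pow, h1, one_pow, mul_one]
    · refine Finset.prod_congr rfl fun i hi => ?_
      have hi' : i ∉ S := Finset.mem_compl.1 hi
      have h1 := hy i
      simp only [hi', if_false] at h1
      rw [flip_apply, if_neg hi', map_pow, h1]
  rw [key, hfy, mul_zero]

/-- A form with multiplicity `k` at the coordinate points has degree at most `d - k` in each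
variable. -/
lemma apply_add_le_of_mem_support {d k : ℕ} (hf : f.IsHomogeneous d) {i : σ}
    (hi : f ∈ maxIdeal (Pi.single i (1 : K)) ^ k) {a : σ →₀ ℕ} (ha : a ∈ f.support) :
    a i + k ≤ d :=
  add_le_of_mem_support_combine (p := fun j : σ => Pi.single j (1 : K)) hf hi
    (by rwa [combine_single])

/-- The degree of a nonzero form with multiplicity `k` at the coordinate points and at a further
point with support `S`. -/
theorem add_le_of_mem_coordinate_of_mem {d k : ℕ} (hf : f.IsHomogeneous d) (h0 : f ≠ 0)
    (hc : ∀ i, f ∈ maxIdeal (Pi.single i (1 : K)) ^ k) {q : σ → K} (hS : ∀ i, i ∈ S ↔ q i ≠ 0)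
    (hq : f ∈ maxIdeal q ^ k) :
    k ≤ d ∧ k + d ≤ (2 * Fintype.card σ - S.card) * (d - k) := by
  have hle : ∀ a ∈ f.support, ∀ i, a i ≤ d - k := fun a ha i => by
    have := apply_add_le_of_mem_support hf (hc i) ha
    omega
  have hkd : k ≤ d := (le_totalDegree_of_mem hq h0).trans hf.totalDegree_le
  refine ⟨hkd, ?_⟩
  have hle' : ∀ a ∈ f.support, ∀ i ∈ S, a i ≤ d - k := fun a ha i _ => hle a ha i
  have h1 := le_totalDegree_of_mem (cremona_mem_maxIdeal_pow hle' (fun i hi => (hS i).1 hi) hq)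
    (cremona_ne_zero hle' h0)
  have h2 : (cremona (d - k) S f).totalDegree + d ≤ (2 * Fintype.card σ - S.card) * (d - k) := by
    obtain ⟨b, hb, hbd⟩ := Finset.exists_mem_eq_sup _
      (support_nonempty.2 (cremona_ne_zero hle' h0)) (fun s : σ →₀ ℕ => s.sum fun _ e => e)
    rw [totalDegree, hbd]
    obtain ⟨a, ha, rfl⟩ := exists_of_mem_support_cremona hb
    have had := degree_eq_of_mem_support hf ha
    rw [Finsupp.degree_eq_sum] at had
    rw [Finsupp.sum_fintype _ _ (by simp), ← had, ← Finset.sum_add_distrib]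
    -- An exponent and its transform add up to `d - k` on `S` and to at most `2 * (d - k)` off `S`.
    have hcard : (2 * Fintype.card σ - S.card) = ∑ i : σ, if i ∈ S then 1 else 2 := by
      have : ∑ i : σ, ((if i ∈ S then 1 else 2) + if i ∈ S then 1 else 0) = 2 * Fintype.card σ := by
        rw [Finset.sum_congr rfl (g := fun _ => 2) (fun i _ => by split_ifs <;> rfl)]
        simp [mul_comm]
      rw [Finset.sum_add_distrib] at this
      simp only [Finset.sum_ite_mem, Finset.univ_inter, Finset.sum_const, smul_eq_mul,
        mul_one] at this
      omega
    rw [hcard, Finset.sum_mul]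
    refine Finset.sum_le_sum fun i _ => ?_
    have := hle a ha i
    rw [flip_apply]
    split_ifs <;> omega
  omega

end Cremona

/-! ### Multiplicity along lines and rational normal curves. -/

section Curve
variable {σ K : Type*} [Fintype σ] [DecidableEq σ] [Field K]

/-- A form of degree `D` with multiplicity `k` at two points has multiplicity `2 * k - D` along
the line through them. -/
theorem mem_maxIdeal_pow_of_line {g : MvPolynomial σ K} {D k : ℕ} (hg : g.IsHomogeneous D)
    {P Q : σ → K} (hP : g ∈ maxIdeal P ^ k) (hQ : g ∈ maxIdeal Q ^ k) (u v : K) :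
    g ∈ maxIdeal (fun i => u * P i + v * Q i) ^ (2 * k - D) := by
  set m := maxIdeal (fun i => u * P i + v * Q i)
  -- The redundant system `P`, `Q`, unit vectors writes `x` as `u P + v Q` plus its deviation from
  -- that point. The exponents of `P` and `Q` are at most `D - k` each, leaving order `2 * k - D` in
  -- the deviation.
  let p : Bool ⊕ σ → σ → K := Sum.elim (fun t => if t then P else Q) fun i => Pi.single i 1
  let z : Bool ⊕ σ → MvPolynomial σ K :=
    Sum.elim (fun t => if t then C u else C v) fun i => X i - C (u * P i + v * Q i)
  have hz : aeval z (combine p g) = g := by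
    rw [aeval_combine]
    conv_rhs => rw [← aeval_X_left_apply (R := K) g]
    congr 2
    ext i : 1
    rw [Fintype.sum_sum_type, Finset.sum_eq_single (a := i) (s := Finset.univ (α := σ))]
    · simp [p, z, MvPolynomial.algebraMap_eq]; ring
    · intro b _ hb
      simp [p, z, hb.symm]
    · simp
  rw [← hz, aeval_def, eval₂_eq']
  refine Ideal.sum_mem _ fun a ha => Ideal.mul_mem_left _ _ ?_
  rw [Fintype.prod_sum_type]
  refine Ideal.mul_mem_left _ _ ?_
  have h1 := add_le_of_mem_support_combine (p := p) (j := Sum.inl true) hg hP ha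
  have h2 := add_le_of_mem_support_combine (p := p) (j := Sum.inl false) hg hQ ha
  have h3 := degree_eq_of_mem_support (combine_isHomogeneous p hg) ha
  rw [Finsupp.degree_eq_sum, Fintype.sum_sum_type, Fintype.sum_bool] at h3
  have h4 : ∏ i : σ, z (Sum.inr i) ^ a (Sum.inr i) ∈ m ^ ∑ i : σ, a (Sum.inr i) := by
    rw [← Finset.prod_pow_eq_pow_sum]
    refine Ideal.prod_mem_prod fun i _ => Ideal.pow_mem_pow ?_ _
    exact Ideal.subset_span ⟨i, rfl⟩
  exact Ideal.pow_le_pow_right (by omega) h4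

lemma cremona_univ_isHomogeneous {f : MvPolynomial σ K} {d e : ℕ} (hf : f.IsHomogeneous d)
    (h : ∀ a ∈ f.support, ∀ i, a i ≤ e) :
    (cremona e Finset.univ f).IsHomogeneous (Fintype.card σ * e - d) := by
  refine IsHomogeneous.sum _ _ _ fun a ha => isHomogeneous_monomial _ ?_
  have had := degree_eq_of_mem_support hf ha
  rw [Finsupp.degree_eq_sum] at had ⊢
  have : ∑ i, flip e Finset.univ a i + ∑ i, a i = Fintype.card σ * e := by
    rw [← Finset.sum_add_distrib, Finset.sum_congr rfl (g := fun _ => e)]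
    · simp
    · intro i _
      have := h a ha i
      simp [flip_apply]; omega
  omega

/-- The multiplicity along the rational normal curve of a form with multiplicity `k` at `n + 3`
points of the curve. -/
theorem mem_maxIdeal_pow_of_curve {f : MvPolynomial σ K} {d k : ℕ} (hf : f.IsHomogeneous d)
    (hc : ∀ i, f ∈ maxIdeal (Pi.single i (1 : K)) ^ k) {a : σ → K} (ha : ∀ i, a i ≠ 0)
    (h1 : f ∈ maxIdeal (fun _ => (1 : K)) ^ k) (h2 : f ∈ maxIdeal (fun i => (a i)⁻¹) ^ k)
    {u v : K} (huv : ∀ i, u + v * a i ≠ 0) :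
    f ∈ maxIdeal (fun i => (u + v * a i)⁻¹) ^ (2 * k - (Fintype.card σ * (d - k) - d)) := by
  have hle : ∀ a ∈ f.support, ∀ i, a i ≤ d - k := fun a ha i => by
    have := apply_add_le_of_mem_support hf (hc i) ha
    omega
  have hle' : ∀ a ∈ f.support, ∀ i ∈ Finset.univ, a i ≤ d - k := fun a ha i _ => hle a ha i
  -- Inversion takes the curve `(u + v * a i)⁻¹` to the line through `1` and `a`; a second inversion
  -- comes back.
  have hP := cremona_mem_maxIdeal_pow hle' (fun i _ => one_ne_zero) h1
  have hQ := cremona_mem_maxIdeal_pow hle' (fun i _ => inv_ne_zero (ha i)) h2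
  have hl := mem_maxIdeal_pow_of_line (cremona_univ_isHomogeneous hf hle) hP hQ u v
  have := cremona_mem_maxIdeal_pow (S := Finset.univ) (e := d - k)
    (fun b hb => support_cremona_le hb) (fun i _ => by simpa [invOn] using huv i) hl
  rw [cremona_cremona hle'] at this
  have e : invOn Finset.univ (fun i => u * invOn Finset.univ (fun _ => (1 : K)) i +
      v * invOn Finset.univ (fun i => (a i)⁻¹) i) = fun i => (u + v * a i)⁻¹ := by
    ext i; simp [invOn]
  rwa [e] at this

end Curve

/-- A form which has multiplicity `μ` at `T` points and does not vanish on their span. -/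
theorem add_card_mul_le_of_eval_sum_ne_zero {σ K ι : Type*} [Field K] [Fintype ι] {f : MvPolynomial σ K}
    {d μ : ℕ} (hf : f.IsHomogeneous d) {p : ι → σ → K} (hp : ∀ j, f ∈ maxIdeal (p j) ^ μ)
    (h : eval (fun i => ∑ j, p j i) f ≠ 0) :
    d + Fintype.card ι * μ ≤ Fintype.card ι * d := by
  have h0 : combine p f ≠ 0 := by
    intro h0
    have := aeval_combine (R := K) p f (fun _ => 1)
    rw [h0] at this
    simp [aeval_eq_eval] at this
    exact h this.symm
  obtain ⟨a, ha⟩ := support_nonempty.2 h0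
  have had := degree_eq_of_mem_support (combine_isHomogeneous p hf) ha
  rw [Finsupp.degree_eq_sum] at had
  -- The exponents of a monomial surviving on the span are at most `d - μ` and add up to `d`.
  have := Finset.sum_le_sum fun j (_ : j ∈ Finset.univ) =>
    add_le_of_mem_support_combine hf (hp j) ha
  rw [Finset.sum_add_distrib, had] at this
  simpa using this

/-! ### Secant spaces of the curve fill a space of odd dimension. -/

section Filling
variable {σ : Type*} [Fintype σ] {F : Type*} [Field F]

/-- The initial form of `f` for the weights `w` decides whether `f` vanishes at a vector of power
series with prescribed leading terms. -/
lemma exists_initialForm [DecidableEq σ] (w : σ → ℕ) {f : MvPolynomial σ F} (hf : f ≠ 0) :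
    ∃ h : MvPolynomial σ F, h ≠ 0 ∧ ∀ y : σ → F, eval y h ≠ 0 → ∀ r : σ → PowerSeries F,
      aeval (fun i => PowerSeries.X ^ w i * (PowerSeries.C (y i) + PowerSeries.X * r i)) f ≠ 0 := by
  let wt : (σ →₀ ℕ) → ℕ := fun a => ∑ i, w i * a i
  obtain ⟨a₀, ha₀, hmin⟩ := f.support.exists_min_image wt (support_nonempty.2 hf)
  let h : MvPolynomial σ F := ∑ a ∈ f.support with wt a = wt a₀, monomial a (coeff a f)
  refine ⟨h, ?_, ?_⟩
  · have : coeff a₀ h = coeff a₀ f := by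
      rw [coeff_sum, Finset.sum_eq_single a₀]
      · simp
      · intro b _ hb
        rw [coeff_monomial, if_neg hb]
      · exact fun hn => (hn (Finset.mem_filter.2 ⟨ha₀, rfl⟩)).elim
    intro h0
    rw [h0, coeff_zero] at this
    exact mem_support_iff.1 ha₀ this.symm
  · intro y hy r h0
    apply hy
    have h1 := congrArg (PowerSeries.coeff (wt a₀)) h0
    rw [map_zero, aeval_def, eval₂_eq', map_sum] at h1
    rw [← h1, map_sum, Finset.sum_filter]
    refine Finset.sum_congr rfl fun a ha => ?_
    have e : ∏ i, (PowerSeries.X ^ w i * (PowerSeries.C (y i) + PowerSeries.X * r i)) ^ a i =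
        PowerSeries.X ^ wt a * ∏ i, (PowerSeries.C (y i) + PowerSeries.X * r i) ^ a i := by
      simp_rw [mul_pow, Finset.prod_mul_distrib, ← pow_mul, wt, Finset.prod_pow_eq_pow_sum]
    have hal : algebraMap F (PowerSeries F) (coeff a f) = PowerSeries.C (coeff a f) := rfl
    rw [e, hal, PowerSeries.coeff_C_mul, PowerSeries.coeff_X_pow_mul']
    split_ifs with h2 h3 h3
    · rw [h2, Nat.sub_self, PowerSeries.coeff_zero_eq_constantCoeff_apply, eval_monomial,
        Finsupp.prod_fintype _ _ (by simp)]
      simp [map_prod]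
    · exact absurd h2.le h3
    · exact absurd (le_antisymm h3 (hmin a ha)) h2
    · simp

/-- The Cauchy matrix of two disjoint sets of equal size is invertible: the inverse is given by
Lagrange interpolation. -/
lemma exists_linear_solution [DecidableEq σ] {a : σ → F} (ha : Function.Injective a)
    (J : Finset σ) (hJ : J.card = Jᶜ.card) :
    ∃ V : σ → σ → F, (∀ j ∈ J, ∀ i ∈ Jᶜ, V j i ≠ 0) ∧
      ∀ y : σ → F, ∀ i ∈ Jᶜ, ∑ j ∈ J, (∑ i' ∈ Jᶜ, V j i' * y i') * (a i - a j)⁻¹ = y i := by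
  have hnode : ∀ i ∈ Jᶜ, ∀ j ∈ J, a i ≠ a j := fun i hi j hj h =>
    Finset.mem_compl.1 hi (ha h ▸ hj)
  have hnod : ∀ i ∈ Jᶜ, (Lagrange.nodal J a).eval (a i) ≠ 0 := fun i hi =>
    Lagrange.eval_nodal_not_at_node (hnode i hi)
  -- These are partial fractions: interpolate `y i * N (a i)` on `Jᶜ`, with `N` the nodal polynomial
  -- of `J`, and take the residues of the interpolant divided by `N` at the nodes `a j`.
  refine ⟨fun j i => Lagrange.nodalWeight J a j * (Lagrange.basis Jᶜ a i).eval (a j) *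
    (Lagrange.nodal J a).eval (a i), fun j hj i hi => ?_, fun y i hi => ?_⟩
  · refine mul_ne_zero (mul_ne_zero (Lagrange.nodalWeight_ne_zero ha.injOn hj) ?_)
      (hnod i hi)
    rw [Lagrange.basis, Polynomial.eval_prod]
    refine Finset.prod_ne_zero_iff.2 fun i' hi' => ?_
    have h1 := Finset.ne_of_mem_erase hi'
    have h2 := hnode i' (Finset.mem_of_mem_erase hi') j hj
    simp only [Lagrange.basisDivisor, Polynomial.eval_mul, Polynomial.eval_C, Polynomial.eval_sub,
      Polynomial.eval_X]
    exact mul_ne_zero (inv_ne_zero (sub_ne_zero.2 fun h => h1 (ha h).symm))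
      (sub_ne_zero.2 h2.symm)
  · set P := Lagrange.interpolate Jᶜ a
      (fun i => y i * (Lagrange.nodal J a).eval (a i)) with hP
    have hPi : P.eval (a i) = y i * (Lagrange.nodal J a).eval (a i) :=
      Lagrange.eval_interpolate_at_node _ ha.injOn hi
    have hdeg : P.degree < J.card := by
      rw [hJ]; exact Lagrange.degree_interpolate_lt _ ha.injOn
    have h1 := congrArg (Polynomial.eval (a i)) (Lagrange.eq_interpolate ha.injOn hdeg)
    rw [Lagrange.eval_interpolate_not_at_node _ (hnode i hi), hPi] at h1
    rw [mul_comm, mul_right_inj' (hnod i hi)] at h1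
    rw [h1]
    refine Finset.sum_congr rfl fun j _ => ?_
    rw [hP, Lagrange.interpolate_apply, Polynomial.eval_finsetSum, Finset.sum_mul, Finset.mul_sum]
    refine Finset.sum_congr rfl fun i' _ => ?_
    rw [Polynomial.eval_mul, Polynomial.eval_C]
    ring

/-- Through a general point of projective space of odd dimension passes a secant space of the
rational normal curve parametrized by the inverses of the points of a line. -/
theorem exists_secant_eval_ne_zero {F : Type u} [Field F] [DecidableEq σ]
    [Infinite F] {a : σ → F} (ha : Function.Injective a) (J : Finset σ) (hJ : J.card = Jᶜ.card)
    {f : MvPolynomial σ F} (hf : f ≠ 0) :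
    ∃ (L : Type u) (_ : Field L) (_ : Algebra F L) (u v : J → L),
      (∀ j i, u j + v j * algebraMap F L (a i) ≠ 0) ∧
      aeval (fun i => ∑ j, (u j + v j * algebraMap F L (a i))⁻¹) f ≠ 0 := by
  classical
  obtain ⟨V, hV0, hV⟩ := exists_linear_solution ha J hJ
  -- Degenerate the curve points to the coordinate points in `J`. Their sum has leading terms `y i`
  -- on `J` and `X * y i` on `Jᶜ`; the Cauchy system makes all these `y i` arbitrary, so it suffices
  -- that the initial form for the weights 0 and 1 is nonzero at `y`.
  obtain ⟨h, hh, hlead⟩ := exists_initialForm (fun i => if i ∈ J then 0 else 1) hf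
  let ℓ : σ → MvPolynomial σ F := fun j => ∑ i ∈ Jᶜ, C (V j i) * X i
  have hℓ : ∀ j ∈ J, ℓ j ≠ 0 := by
    intro j hj h0
    obtain ⟨i, hi⟩ : Jᶜ.Nonempty := Finset.card_pos.1 (hJ ▸ Finset.card_pos.2 ⟨j, hj⟩)
    have := congrArg (eval (Pi.single i 1)) h0
    rw [map_zero, map_sum, Finset.sum_eq_single i] at this
    · simp [hV0 j hj i hi] at this
    · intro b _ hb
      simp [hb]
    · exact fun h => absurd hi h
  have hH : h * (∏ j ∈ J, X j) * ∏ j ∈ J, ℓ j ≠ 0 :=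
    mul_ne_zero (mul_ne_zero hh (Finset.prod_ne_zero_iff.2 fun j _ => X_ne_zero j))
      (Finset.prod_ne_zero_iff.2 hℓ)
  obtain ⟨y, hy⟩ : ∃ y : σ → F, eval y (h * (∏ j ∈ J, X j) * ∏ j ∈ J, ℓ j) ≠ 0 := by
    by_contra! hcon
    exact hH (MvPolynomial.funext fun y => by rw [hcon y, map_zero])
  rw [map_mul, map_mul, map_prod, map_prod] at hy
  have hy1 : eval y h ≠ 0 := left_ne_zero_of_mul (left_ne_zero_of_mul hy)
  have hy2 : ∀ j ∈ J, y j ≠ 0 := fun j hj => by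
    simpa using Finset.prod_ne_zero_iff.1 (right_ne_zero_of_mul (left_ne_zero_of_mul hy)) j hj
  let s : σ → F := fun j => ∑ i ∈ Jᶜ, V j i * y i
  have hs : ∀ j ∈ J, s j ≠ 0 := fun j hj => by
    simpa [ℓ] using Finset.prod_ne_zero_iff.1 (right_ne_zero_of_mul hy) j hj
  have hsum : ∀ i ∈ Jᶜ, ∑ j ∈ J, s j * (a i - a j)⁻¹ = y i := hV y
  -- Chosen so that `X * s j / D j i` equals `y j` for `i = j` and starts with `X * s j / (a i - a
  -- j)` otherwise, while `D j i` stays affine linear in `a i`, as points of the curve require.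
  let D : σ → σ → PowerSeries F := fun j i =>
    PowerSeries.C (a i - a j) + PowerSeries.X * PowerSeries.C (s j / y j)
  have hD : ∀ j i, i ≠ j → ∃ r : PowerSeries F,
      (PowerSeries.C (a i - a j)⁻¹ + PowerSeries.X * r) * D j i = 1 := by
    intro j i hij
    have hc : PowerSeries.constantCoeff (D j i) = a i - a j := by simp [D]
    have hinv := PowerSeries.inv_mul_cancel (D j i)
      (by rw [hc]; exact sub_ne_zero.2 fun h => hij (ha h))
    obtain ⟨r, hr⟩ := PowerSeries.X_dvd_iff.2
      (show PowerSeries.constantCoeff ((D j i)⁻¹ - PowerSeries.C (a i - a j)⁻¹) = 0 by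
        rw [map_sub, PowerSeries.constantCoeff_inv, hc]; simp)
    refine ⟨r, ?_⟩
    rw [← hr, add_sub_cancel, hinv]
  choose! r hr using hD
  let p : σ → σ → PowerSeries F := fun j i => if i = j then PowerSeries.C (y j) else
    PowerSeries.X * (PowerSeries.C (s j) * (PowerSeries.C (a i - a j)⁻¹ + PowerSeries.X * r j i))
  have hp : ∀ j ∈ J, ∀ i, p j i * D j i = PowerSeries.X * PowerSeries.C (s j) := by
    intro j hj i
    by_cases hij : i = j
    · simp only [p, D, hij, if_true, sub_self, map_zero, zero_add]
      rw [mul_left_comm, ← map_mul, mul_div_cancel₀ _ (hy2 j hj)]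
    · simp only [p, hij, if_false]
      rw [mul_assoc, mul_assoc, hr j i hij, mul_one]
  have hX : ∃ x : σ → PowerSeries F, (fun i => ∑ j ∈ J, p j i) = fun i =>
      PowerSeries.X ^ (if i ∈ J then 0 else 1) * (PowerSeries.C (y i) + PowerSeries.X * x i) := by
    refine ⟨fun i => if i ∈ J then ∑ j ∈ J.erase i, (PowerSeries.C (s j) *
      (PowerSeries.C (a i - a j)⁻¹ + PowerSeries.X * r j i)) else
      ∑ j ∈ J, PowerSeries.C (s j) * r j i, ?_⟩
    ext1 i
    by_cases hi : i ∈ J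
    · simp only [hi, if_true, pow_zero, one_mul]
      rw [← Finset.add_sum_erase _ _ hi, Finset.mul_sum]
      congr 1
      · simp [p]
      · refine Finset.sum_congr rfl fun j hj => ?_
        simp only [p, (Finset.ne_of_mem_erase hj).symm, if_false]
    · simp only [hi, if_false, pow_one]
      rw [← hsum i (Finset.mem_compl.2 hi), map_sum, Finset.mul_sum, ← Finset.sum_add_distrib,
        Finset.mul_sum]
      refine Finset.sum_congr rfl fun j hj => ?_
      have hij : i ≠ j := fun h => hi (h ▸ hj)
      simp only [p, hij, if_false, map_mul]
      ring
  obtain ⟨x, hx⟩ := hX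
  have hne := hlead y hy1 x
  rw [← hx] at hne
  let L := FractionRing (PowerSeries F)
  let φ := algebraMap (PowerSeries F) L
  have hφ : Function.Injective φ := IsFractionRing.injective _ _
  have hφa : ∀ c : F, φ (PowerSeries.C c) = algebraMap F L c := fun c => rfl
  have hXs : ∀ j ∈ J, φ (PowerSeries.X * PowerSeries.C (s j)) ≠ 0 := fun j hj => by
    rw [Ne, map_eq_zero_iff φ hφ]
    refine mul_ne_zero PowerSeries.X_ne_zero fun h => hs j hj ?_
    simpa using congrArg PowerSeries.constantCoeff h
  have hrel : ∀ j ∈ J, ∀ i, φ (p j i) * φ (D j i) = φ (PowerSeries.X * PowerSeries.C (s j)) :=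
    fun j hj i => by rw [← map_mul, hp j hj i]
  let v : J → L := fun j => (φ (PowerSeries.X * PowerSeries.C (s j)))⁻¹
  let u : J → L := fun j =>
    v j * (φ (PowerSeries.X * PowerSeries.C (s j / y j)) - algebraMap F L (a j))
  have huv : ∀ (j : J) i, u j + v j * algebraMap F L (a i) = v j * φ (D j i) := by
    intro j i
    simp only [u, D, map_add, map_sub, hφa]
    ring
  have hinv : ∀ (j : J) i, (v j * φ (D j i))⁻¹ = φ (p j i) := by
    intro j i
    refine inv_eq_of_mul_eq_one_left ?_
    rw [mul_left_comm, hrel j j.2 i]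
    exact inv_mul_cancel₀ (hXs j j.2)
  refine ⟨L, inferInstance, inferInstance, u, v, fun j i => ?_, ?_⟩
  · rw [huv]
    refine mul_ne_zero (inv_ne_zero (hXs j j.2)) fun h => hXs j j.2 ?_
    rw [← hrel j j.2 i, h, mul_zero]
  · simp_rw [huv, hinv]
    have : (fun i => ∑ j : J, φ (p j i)) = fun i => φ (∑ j ∈ J, p j i) := by
      ext1 i
      rw [map_sum, Finset.sum_coe_sort J fun j => φ (p j i)]
    rw [this]
    have e := MvPolynomial.aeval_algebraMap_apply L (fun i => ∑ j ∈ J, p j i) f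
    intro h0
    exact hne (hφ (by rw [map_zero, ← h0]; exact e.symm))

end Filling

/-- The degree of a nonzero form with multiplicity `k` at the `n + 3 = 2 * T + 2` points of a
rational normal curve in a projective space of odd dimension. -/
theorem secant_bound {σ : Type*} [Fintype σ] [DecidableEq σ] {K : Type u} [Field K]
    {f : MvPolynomial σ K} {d k T : ℕ} (hcard : Fintype.card σ = 2 * T)
    (hf : f.IsHomogeneous d) (h0 : f ≠ 0)
    (hc : ∀ i, f ∈ maxIdeal (Pi.single i (1 : K)) ^ k) {a : σ → K} (ha : ∀ i, a i ≠ 0)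
    (hinj : Function.Injective a) (h1 : f ∈ maxIdeal (fun _ => (1 : K)) ^ k)
    (h2 : f ∈ maxIdeal (fun i => (a i)⁻¹) ^ k) :
    d + T * (2 * k - (2 * T * (d - k) - d)) ≤ T * d := by
  -- The choice of a general point needs an infinite field.
  let F := AlgebraicClosure K
  have hF : Infinite F := IsAlgClosed.instInfinite
  obtain ⟨J, hJ⟩ := Finset.exists_subset_card_eq
    (show T ≤ (Finset.univ : Finset σ).card by rw [Finset.card_univ]; omega)
  have hJ' : J.card = Jᶜ.card := by rw [Finset.card_compl, hJ.2, hcard]; omega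
  obtain ⟨L, _, _, u, v, huv, hne⟩ := exists_secant_eval_ne_zero
    (a := fun i => algebraMap K F (a i)) ((algebraMap K F).injective.comp hinj) J hJ'
    (f := map (algebraMap K F) f)
    (fun h => h0 (map_injective _ (algebraMap K F).injective (by rw [h, map_zero])))
  let ψ : K →+* L := (algebraMap F L).comp (algebraMap K F)
  have hψ : ∀ {p : σ → K}, f ∈ maxIdeal p ^ k → map ψ f ∈ maxIdeal (fun i => ψ (p i)) ^ k :=
    fun h => map_mem_maxIdeal_pow ψ h
  have hp : ∀ j : J, map ψ f ∈ maxIdeal (fun i => (u j + v j * ψ (a i))⁻¹) ^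
      (2 * k - (2 * T * (d - k) - d)) := fun j => by
    rw [← hcard]
    refine mem_maxIdeal_pow_of_curve (hf.map ψ) (fun i => ?_)
      (fun i => (map_ne_zero ψ).2 (ha i)) ?_ ?_ (huv j)
    · have := hψ (hc i)
      have e : (fun i' => ψ ((Pi.single i (1 : K) : σ → K) i')) = Pi.single i (1 : L) := by
        ext i'
        by_cases h : i' = i
        · subst h; simp
        · simp [h]
      rwa [e] at this
    · simpa using hψ h1
    · simpa using hψ h2
  have := add_card_mul_le_of_eval_sum_ne_zero (hf.map ψ) hp (by
    rw [aeval_def, eval₂_map] at hne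
    rw [eval_map]
    exact hne)
  simpa [hJ.2] using this

/-! ### Degree bounds for points in arbitrary coordinates. -/

section Lower
variable {K : Type*} [Field K] {n : ℕ}

lemma pointIdeal_le_maxIdeal (P : ℙ K (Fin (n + 1) → K)) (c : K) :
    pointIdeal P ≤ maxIdeal (c • P.rep) := by
  rw [pointIdeal, Ideal.span_le]
  rintro f ⟨⟨d, hd⟩, hf⟩
  rw [SetLike.mem_coe, mem_maxIdeal_iff, eval_eq']
  rw [eval_eq'] at hf
  have : ∀ a ∈ f.support, coeff a f * ∏ i, (c • P.rep) i ^ a i =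
      c ^ d * (coeff a f * ∏ i, P.rep i ^ a i) := by
    intro a ha
    have := degree_eq_of_mem_support hd ha
    rw [Finsupp.degree_eq_sum] at this
    simp only [Pi.smul_apply, smul_eq_mul, mul_pow, Finset.prod_mul_distrib,
      Finset.prod_pow_eq_pow_sum, this]
    ring
  rw [Finset.sum_congr rfl this, ← Finset.mul_sum, hf, mul_zero]

lemma mem_maxIdeal_pow_of_mem_symbolicPower {Z : Finset (ℙ K (Fin (n + 1) → K))} {k : ℕ}
    {f : MvPolynomial (Fin (n + 1)) K} (hf : f ∈ symbolicPower Z k)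
    {P : ℙ K (Fin (n + 1) → K)} (hP : P ∈ Z) (c : K) : f ∈ maxIdeal (c • P.rep) ^ k := by
  rw [symbolicPower] at hf
  simp only [Submodule.mem_iInf] at hf
  exact Ideal.pow_right_mono (pointIdeal_le_maxIdeal P c) k (hf P hP)

lemma combine_mem_maxIdeal_pow {σ ι : Type*} [Fintype ι] {p : ι → σ → K} {f : MvPolynomial σ K}
    {k : ℕ} {c : ι → K} {q : σ → K} (hq : q = ∑ j, c j • p j) (hf : f ∈ maxIdeal q ^ k) :
    combine p f ∈ maxIdeal c ^ k := by
  refine aeval_mem_pow (fun i => ?_) hf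
  have : ∑ j, C (p j i) * X j - algebraMap K (MvPolynomial ι K) (q i) =
      ∑ j, C (p j i) * (X j - C (c j)) := by
    rw [hq]
    simp [mul_sub, Finset.sum_sub_distrib, MvPolynomial.algebraMap_eq, mul_comm]
  rw [this]
  exact Ideal.sum_mem _ fun j _ => Ideal.mul_mem_left _ _ (Ideal.subset_span ⟨j, rfl⟩)

lemma combine_basis_ne_zero {σ ι : Type*} [Fintype ι] [Fintype σ] [DecidableEq σ]
    (B : Module.Basis ι K (σ → K)) {f : MvPolynomial σ K} (hf : f ≠ 0) : combine B f ≠ 0 := by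
  intro h
  apply hf
  have h1 := aeval_combine B f (fun j => ∑ i, C (B.repr (Pi.single i 1) j) * X i :
    ι → MvPolynomial σ K)
  rw [h, map_zero] at h1
  rw [h1]
  conv_lhs => rw [← aeval_X_left_apply (R := K) f]
  congr 2
  ext i : 1
  simp_rw [Finset.mul_sum]
  rw [Finset.sum_comm, Finset.sum_eq_single i]
  · have := congrFun (B.sum_repr (Pi.single i 1)) i
    simp only [Finset.sum_apply, Pi.smul_apply, Pi.single_eq_same, smul_eq_mul] at this
    simp_rw [← mul_assoc, MvPolynomial.algebraMap_eq, ← map_mul, ← Finset.sum_mul, ← map_sum,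
      mul_comm (B _ i), this]
    simp
  · intro i' _ hi'
    have := congrFun (B.sum_repr (Pi.single i' 1)) i
    rw [Pi.single_eq_of_ne hi'.symm] at this
    simp only [Finset.sum_apply, Pi.smul_apply, smul_eq_mul] at this
    simp_rw [← mul_assoc, MvPolynomial.algebraMap_eq, ← map_mul, ← Finset.sum_mul, ← map_sum,
      mul_comm (B _ i), this]
    simp
  · simp

variable (B : Module.Basis (Fin (n + 1)) K (Fin (n + 1) → K))
  {f : MvPolynomial (Fin (n + 1)) K} {d k : ℕ}

lemma combine_mem_single (hB : ∀ i, f ∈ maxIdeal (B i) ^ k) (i : Fin (n + 1)) :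
    combine B f ∈ maxIdeal (Pi.single i (1 : K)) ^ k :=
  combine_mem_maxIdeal_pow (q := B i) (by simp [Pi.single_apply]) (hB i)

theorem degree_bound_of_basis (hf : f.IsHomogeneous d) (h0 : f ≠ 0)
    (hB : ∀ i, f ∈ maxIdeal (B i) ^ k) {q : Fin (n + 1) → K} (hq : f ∈ maxIdeal q ^ k)
    {S : Finset (Fin (n + 1))} (hS : ∀ i, i ∈ S ↔ B.repr q i ≠ 0) :
    k ≤ d ∧ k + d ≤ (2 * (n + 1) - S.card) * (d - k) := by
  have := add_le_of_mem_coordinate_of_mem (S := S) (combine_isHomogeneous B hf)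
    (combine_basis_ne_zero B h0) (combine_mem_single B hB) (q := B.repr q) hS
    (combine_mem_maxIdeal_pow (B.sum_repr q).symm hq)
  simpa using this

theorem degree_bound_of_odd {T : ℕ} (hT : n + 1 = 2 * T) (hf : f.IsHomogeneous d) (h0 : f ≠ 0)
    (hB : ∀ i, f ∈ maxIdeal (B i) ^ k) {t : Fin (n + 1) → K} (ht : ∀ i, t i ≠ 0)
    (hinj : Function.Injective t)
    (h1 : f ∈ maxIdeal (∑ i, B i) ^ k) (h2 : f ∈ maxIdeal (∑ i, (t i)⁻¹ • B i) ^ k) :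
    d + T * (2 * k - (2 * T * (d - k) - d)) ≤ T * d :=
  secant_bound (by simpa using hT) (combine_isHomogeneous B hf) (combine_basis_ne_zero B h0)
    (combine_mem_single B hB) ht hinj (combine_mem_maxIdeal_pow (by simp) h1)
    (combine_mem_maxIdeal_pow rfl h2)

end Lower

/-! ### Products of forms and cyclic bookkeeping of defects. -/

section Upper
variable {K : Type*} [Field K] {n : ℕ} {ι : Type*}

/-- There is a nonzero form of degree `δ` with multiplicity at least `δ - u i` at `p i`. -/
def HasForm (p : ι → ℙ K (Fin (n + 1) → K)) (δ : ℕ) (u : ι → ℕ) : Prop :=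
  ∃ f : MvPolynomial (Fin (n + 1)) K, f ≠ 0 ∧ f.IsHomogeneous δ ∧
    ∀ i, f ∈ pointIdeal (p i) ^ (δ - u i)

variable {p : ι → ℙ K (Fin (n + 1) → K)} {δ δ' : ℕ} {u u' : ι → ℕ}

lemma HasForm.zero (p : ι → ℙ K (Fin (n + 1) → K)) (u : ι → ℕ) : HasForm p 0 u :=
  ⟨1, one_ne_zero, isHomogeneous_one _ _, fun i => by simp⟩

lemma HasForm.mono (h : HasForm p δ u) (hu : ∀ i, u i ≤ u' i) : HasForm p δ u' := by
  obtain ⟨f, h0, h1, h2⟩ := h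
  exact ⟨f, h0, h1, fun i => Ideal.pow_le_pow_right (Nat.sub_le_sub_left (hu i) δ) (h2 i)⟩

lemma HasForm.mul (h : HasForm p δ u) (h' : HasForm p δ' u') :
    HasForm p (δ + δ') fun i => u i + u' i := by
  obtain ⟨f, h0, h1, h2⟩ := h
  obtain ⟨f', h0', h1', h2'⟩ := h'
  refine ⟨f * f', mul_ne_zero h0 h0', h1.mul h1', fun i => ?_⟩
  have := Ideal.mul_mem_mul (h2 i) (h2' i)
  rw [← pow_add] at this
  exact Ideal.pow_le_pow_right (by dsimp only; omega) this

/-- The number of occurrences of `i` in the window `[x, y)` of the sequence `e`. -/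
def occ [DecidableEq ι] (e : ℕ → ι) (x y : ℕ) (i : ι) : ℕ := {z ∈ Finset.Ico x y | e z = i}.card

lemma occ_add [DecidableEq ι] (e : ℕ → ι) {x y z : ℕ} (hxy : x ≤ y) (hyz : y ≤ z) (i : ι) :
    occ e x y i + occ e y z i = occ e x z i := by
  simp only [occ, Finset.card_filter]
  exact Finset.sum_Ico_consecutive _ hxy hyz

/-- Defects add under multiplication and consecutive windows concatenate, so the product is
deficient on one long window, which `occ_cyc_le` shows to be evenly spread. -/
lemma HasForm.windows [DecidableEq ι] {e : ℕ → ι} {l : ℕ}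
    (h : ∀ x, HasForm p δ (occ e x (x + l))) (x m : ℕ) :
    HasForm p (m * δ) (occ e x (x + m * l)) := by
  induction m with
  | zero => simpa using HasForm.zero p _
  | succ m ih =>
    have := ih.mul (h (x + m * l))
    rw [add_one_mul, add_one_mul, ← add_assoc]
    refine this.mono fun i => ?_
    rw [occ_add e (Nat.le_add_right _ _) (Nat.le_add_right _ _)]

/-- The sequence that runs cyclically through the values of `g`. -/
def cyc {N : ℕ} [NeZero N] (g : Fin N → ι) (y : ℕ) : ι := g (Fin.ofNat N y)

lemma injOn_cyc {N : ℕ} [NeZero N] {g : Fin N → ι} (hg : Function.Injective g) {x l : ℕ} (hl : l ≤ N) :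
    Set.InjOn (cyc g) (Finset.Ico x (x + l)) := by
  intro z hz z' hz' h
  have h2 : z ≡ z' [MOD N] := congrArg Fin.val (hg h)
  simp only [Finset.coe_Ico, Set.mem_Ico] at hz hz'
  rcases le_total z z' with hle | hle
  · have := (Nat.modEq_iff_dvd' hle).1 h2
    have := Nat.eq_zero_of_dvd_of_lt this (by omega)
    omega
  · have := (Nat.modEq_iff_dvd' hle).1 h2.symm
    have := Nat.eq_zero_of_dvd_of_lt this (by omega)
    omega

section Cyc
variable [DecidableEq ι] {N : ℕ} [NeZero N] {g : Fin N → ι}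

lemma occ_cyc_le (hg : Function.Injective g) {c y : ℕ} (hy : y ≤ N * c) (i : ι) :
    occ (cyc g) 0 y i ≤ c := by
  rw [← Finset.card_range c]
  refine Finset.card_le_card_of_injOn (· / N) (fun z hz => ?_) (fun z hz z' hz' h => ?_)
  · have := (Finset.mem_Ico.1 (Finset.mem_filter.1 hz).1).2
    simp only [Finset.coe_range, Set.mem_Iio]
    exact Nat.div_lt_of_lt_mul (by omega)
  · have h1 := (Finset.mem_filter.1 hz).2
    rw [← (Finset.mem_filter.1 hz').2] at h1
    have h2 := congrArg Fin.val (hg h1)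
    simp only [Fin.ofNat] at h2
    dsimp only at h
    rw [← Nat.div_add_mod z N, ← Nat.div_add_mod z' N, h, h2]

lemma occ_cyc_eq_zero {i : ι} (hi : ∀ j, g j ≠ i) (x y : ℕ) : occ (cyc g) x y i = 0 := by
  rw [occ, Finset.card_eq_zero, Finset.filter_eq_empty_iff]
  exact fun z _ => hi _

lemma card_occ_cyc_eq_zero [Fintype ι] (hg : Function.Injective g) {x l : ℕ} (hl : l ≤ N) :
    ({i | occ (cyc g) x (x + l) i = 0} : Finset ι).card = Fintype.card ι - l := by
  have : ({i | occ (cyc g) x (x + l) i = 0} : Finset ι) =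
      ((Finset.Ico x (x + l)).image (cyc g))ᶜ := by
    ext i
    simp only [occ, Finset.card_eq_zero, Finset.filter_eq_empty_iff, Finset.mem_filter,
      Finset.mem_univ, true_and, Finset.mem_compl, Finset.mem_image, not_exists, not_and]
  rw [this, Finset.card_compl, Finset.card_image_of_injOn (injOn_cyc hg hl)]
  simp

end Cyc

/-- The linear form given by a functional. -/
noncomputable def linForm (φ : Module.Dual K (Fin (n + 1) → K)) : MvPolynomial (Fin (n + 1)) K :=
  ∑ i, C (φ (Pi.single i 1)) * X i

lemma linForm_isHomogeneous (φ : Module.Dual K (Fin (n + 1) → K)) :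
    (linForm φ).IsHomogeneous 1 :=
  IsHomogeneous.sum _ _ _ fun i _ => by
    simpa using (isHomogeneous_C _ (φ (Pi.single i 1))).mul (isHomogeneous_X K i)

lemma eval_linForm (φ : Module.Dual K (Fin (n + 1) → K)) (x : Fin (n + 1) → K) :
    eval x (linForm φ) = φ x := by
  conv_rhs => rw [LinearMap.pi_apply_eq_sum_univ φ x]
  simp only [linForm, map_sum, map_mul, eval_C, eval_X, smul_eq_mul]
  refine Finset.sum_congr rfl fun i _ => ?_
  rw [mul_comm]
  congr 2
  ext j
  simp [Pi.single_apply, eq_comm]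

lemma linForm_sub (φ ψ : Module.Dual K (Fin (n + 1) → K)) :
    linForm (φ - ψ) = linForm φ - linForm ψ := by
  simp [linForm, sub_mul, Finset.sum_sub_distrib]

lemma linForm_smul (c : K) (φ : Module.Dual K (Fin (n + 1) → K)) :
    linForm (c • φ) = C c * linForm φ := by
  simp [linForm, Finset.mul_sum, mul_assoc]

lemma linForm_mem_pointIdeal {φ : Module.Dual K (Fin (n + 1) → K)} {P : ℙ K (Fin (n + 1) → K)}
    (h : φ P.rep = 0) : linForm φ ∈ pointIdeal P :=
  Ideal.subset_span ⟨⟨1, linForm_isHomogeneous φ⟩, by rw [eval_linForm, h]⟩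

lemma HasForm.of_functional {φ : Module.Dual K (Fin (n + 1) → K)} (hφ : φ ≠ 0)
    (h : ∀ i, u i = 0 → φ (p i).rep = 0) : HasForm p 1 u := by
  refine ⟨linForm φ, fun h0 => hφ ?_, linForm_isHomogeneous φ, fun i => ?_⟩
  · ext1 x
    have := eval_linForm φ (Pi.single x 1)
    rw [h0, map_zero] at this
    ext
    simpa using this.symm
  · by_cases hi : u i = 0
    · simpa [hi] using linForm_mem_pointIdeal (h i hi)
    · rw [show 1 - u i = 0 by omega]
      simp

/-- At most `n` points always lie on a hyperplane; only points without allowed defect impose a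
condition. -/
lemma HasForm.of_card_le [Fintype ι] (h : ({i | u i = 0} : Finset ι).card ≤ n) : HasForm p 1 u := by
  classical
  let W := Submodule.span K ((Finset.image (fun i => (p i).rep) {i | u i = 0} :
    Finset (Fin (n + 1) → K)) : Set (Fin (n + 1) → K))
  have hW : W < ⊤ := by
    refine lt_top_iff_ne_top.2 fun hW => ?_
    have h1 := (finrank_span_finset_le_card (R := K)
      (Finset.image (fun i => (p i).rep) {i | u i = 0})).trans Finset.card_image_le
    change Module.finrank K W ≤ _ at h1
    rw [hW, finrank_top, Module.finrank_fin_fun] at h1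
    omega
  obtain ⟨φ, hφ, hφW⟩ := Submodule.exists_le_ker_of_lt_top W hW
  refine HasForm.of_functional hφ fun i hi => hφW (Submodule.subset_span ?_)
  exact Finset.mem_coe.2 (Finset.mem_image_of_mem _ (by simpa using hi))

end Upper

/-! ### Determinants of matrices of low rank modulo an ideal. -/

section Determinant
variable {R : Type*} [CommRing R] {m : ℕ}

lemma det_mem_pow {I : Ideal R} {A : Matrix (Fin (m + 1)) (Fin (m + 1)) R}
    (h : ∀ i j, A i j ∈ I) : A.det ∈ I ^ (m + 1) := by
  rw [Matrix.det_apply]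
  refine Ideal.sum_mem _ fun s _ => Submodule.smul_of_tower_mem _ _ ?_
  have := Ideal.prod_mem_prod (s := Finset.univ) (I := fun _ => I)
    (x := fun i => A (s i) i) fun i _ => h _ _
  simpa using this

lemma det_mem_pow_of_row {I : Ideal R} {A : Matrix (Fin (m + 1)) (Fin (m + 1)) R}
    {k : Fin (m + 1)} (h : ∀ i, i ≠ k → ∀ j, A i j ∈ I) : A.det ∈ I ^ m := by
  rw [Matrix.det_apply]
  refine Ideal.sum_mem _ fun s _ => Submodule.smul_of_tower_mem _ _ ?_
  rw [← Finset.mul_prod_erase _ _ (Finset.mem_univ (s.symm k))]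
  refine Ideal.mul_mem_left _ _ ?_
  have := Ideal.prod_mem_prod (s := Finset.univ.erase (s.symm k)) (I := fun _ => I)
    (x := fun i => A (s i) i) fun i hi => h _ (fun h => Finset.ne_of_mem_erase hi (by simp [← h])) _
  simpa using this

lemma det_mem_pow_of_rank_one {I : Ideal R} {A : Matrix (Fin (m + 1)) (Fin (m + 1)) R}
    {k : Fin (m + 1)} {c : Fin (m + 1) → R} (h : ∀ i j, A i j - c i * A k j ∈ I) :
    A.det ∈ I ^ m := by
  let B : Matrix (Fin (m + 1)) (Fin (m + 1)) R :=
    fun i j => A i j - (if i = k then 0 else c i) * A k j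
  have : A.det = B.det := Matrix.det_eq_of_forall_row_eq_smul_add_const
    (fun i => if i = k then 0 else c i) k (by simp) (fun i j => by simp [B])
  rw [this]
  refine det_mem_pow_of_row (k := k) fun i hi j => ?_
  simpa [B, hi] using h i j

end Determinant

/-! ### Hankel determinants: secant varieties and cones over them. -/

section Secant
variable {K : Type*} [Field K] {n m : ℕ}

/-- The determinant of a matrix of linear forms. -/
noncomputable def detForm
    (M : Matrix (Fin (m + 1)) (Fin (m + 1)) (Module.Dual K (Fin (n + 1) → K))) :
    MvPolynomial (Fin (n + 1)) K :=
  (Matrix.of fun i j => linForm (M i j)).det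

lemma detForm_isHomogeneous
    (M : Matrix (Fin (m + 1)) (Fin (m + 1)) (Module.Dual K (Fin (n + 1) → K))) :
    (detForm M).IsHomogeneous (m + 1) := by
  rw [detForm, Matrix.det_apply']
  refine IsHomogeneous.sum _ _ _ fun s _ => ?_
  have h := IsHomogeneous.prod Finset.univ (fun i => linForm (M (s i) i)) (fun _ => 1)
    fun i _ => linForm_isHomogeneous _
  have h1 : (((Equiv.Perm.sign s : ℤˣ) : ℤ) : MvPolynomial (Fin (n + 1)) K) =
      C (((Equiv.Perm.sign s : ℤˣ) : ℤ) : K) := by simp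
  rw [h1]
  have h2 := (isHomogeneous_C (Fin (n + 1)) (((Equiv.Perm.sign s : ℤˣ) : ℤ) : K)).mul h
  rwa [Finset.sum_const, Finset.card_univ, Fintype.card_fin, smul_eq_mul, mul_one, zero_add] at h2

lemma eval_detForm (M : Matrix (Fin (m + 1)) (Fin (m + 1)) (Module.Dual K (Fin (n + 1) → K)))
    (x : Fin (n + 1) → K) : eval x (detForm M) = (Matrix.of fun i j => M i j x).det := by
  rw [detForm, RingHom.map_det]
  congr 1
  ext i j
  simp [eval_linForm]

lemma detForm_mem_of_zero {M : Matrix (Fin (m + 1)) (Fin (m + 1)) (Module.Dual K (Fin (n + 1) → K))}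
    {P : ℙ K (Fin (n + 1) → K)} {x : Fin (n + 1) → K} (hx : ∃ c : K, P.rep = c • x)
    (h : ∀ i j, M i j x = 0) : detForm M ∈ pointIdeal P ^ (m + 1) := by
  obtain ⟨c, hc⟩ := hx
  exact det_mem_pow fun i j => linForm_mem_pointIdeal (by rw [hc, map_smul, h, smul_zero])

lemma detForm_mem_of_rank_one
    {M : Matrix (Fin (m + 1)) (Fin (m + 1)) (Module.Dual K (Fin (n + 1) → K))}
    {P : ℙ K (Fin (n + 1) → K)} {x : Fin (n + 1) → K} (hx : ∃ c : K, P.rep = c • x)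
    {k : Fin (m + 1)} {v : Fin (m + 1) → K} (h : ∀ i j, M i j x = v i * M k j x) :
    detForm M ∈ pointIdeal P ^ m := by
  obtain ⟨c, hc⟩ := hx
  refine det_mem_pow_of_rank_one (k := k) (c := fun i => C (v i)) fun i j => ?_
  change linForm _ - C (v i) * linForm _ ∈ _
  rw [← linForm_smul, ← linForm_sub]
  refine linForm_mem_pointIdeal ?_
  rw [hc, map_smul, LinearMap.sub_apply, LinearMap.smul_apply, h]
  simp

/-- The leading coefficient in Lagrange interpolation at `n + 1` nodes. The weights in
`secantMatrix` are designed for this identity. -/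
lemma sum_eval_div_prod {t : Fin (n + 1) → K} (ht : Function.Injective t) {φ : Polynomial K}
    (hφ : φ.natDegree ≤ n) :
    ∑ l, φ.eval (t l) / ∏ j ∈ Finset.univ.erase l, (t l - t j) = φ.coeff n := by
  have := Lagrange.coeff_eq_sum (s := Finset.univ) (v := t) ht.injOn (P := φ)
    (by
      rw [Finset.card_univ, Fintype.card_fin]
      exact lt_of_le_of_lt Polynomial.degree_le_natDegree (by exact_mod_cast Nat.lt_succ_of_le hφ))
  simpa using this.symm

variable (B : Module.Basis (Fin (n + 1)) K (Fin (n + 1) → K)) (t : Fin (n + 1) → K)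
  (φ : Polynomial K)

/-- A symmetric matrix of linear forms that has rank one along a rational normal curve. -/
noncomputable def secantMatrix (m : ℕ) :
    Matrix (Fin (m + 1)) (Fin (m + 1)) (Module.Dual K (Fin (n + 1) → K)) :=
  fun a b => ∑ l, ((φ.eval (t l) / ∏ j ∈ Finset.univ.erase l, (t l - t j)) *
    t l ^ (a + b : ℕ)) • B.coord l

lemma secantMatrix_apply (a b : Fin (m + 1)) (y : Fin (n + 1) → K) :
    secantMatrix B t φ m a b (∑ l, y l • B l) =
      ∑ l, (φ.eval (t l) / ∏ j ∈ Finset.univ.erase l, (t l - t j)) * t l ^ (a + b : ℕ) * y l := by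
  simp [secantMatrix, Finsupp.single_apply, mul_comm]

lemma secantMatrix_apply_basis (a b : Fin (m + 1)) (l : Fin (n + 1)) :
    secantMatrix B t φ m a b (B l) =
      (φ.eval (t l) / ∏ j ∈ Finset.univ.erase l, (t l - t j)) * t l ^ (a + b : ℕ) := by
  simp [secantMatrix, Finsupp.single_apply]

variable {B t φ}

/-- This is the point at infinity of the curve. Since the polynomial has degree at most `n`, only
the last corner `a = b = m` can be nonzero, and not even that if `φ.natDegree + 2 * m < n`. -/
lemma secantMatrix_apply_one (ht : Function.Injective t) (hφ : φ.natDegree + 2 * m ≤ n)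
    (a b : Fin (m + 1)) :
    secantMatrix B t φ m a b (∑ l, B l) = (φ * Polynomial.X ^ (a + b : ℕ)).coeff n := by
  have h := secantMatrix_apply B t φ a b (fun _ => 1)
  simp only [one_smul, mul_one] at h
  rw [h, ← sum_eval_div_prod ht]
  · simp [div_mul_eq_mul_div]
  · refine Polynomial.natDegree_mul_le.trans ?_
    have := Polynomial.natDegree_X_pow_le (R := K) (a + b : ℕ)
    omega

/-- This is the point of parameter zero. The inverses lower the exponent by one, so the sum is a
coefficient beyond the degree; only the corner `a = b = 0` escapes, unless `X ∣ φ`. -/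
lemma secantMatrix_apply_inv (ht : Function.Injective t) (h0 : ∀ l, t l ≠ 0)
    (hφ : φ.natDegree + 2 * m ≤ n)
    (a b : Fin (m + 1)) (hab : (a + b : ℕ) ≠ 0) :
    secantMatrix B t φ m a b (∑ l, (t l)⁻¹ • B l) = 0 := by
  obtain ⟨e, he⟩ := Nat.exists_eq_succ_of_ne_zero hab
  have hd : (φ * Polynomial.X ^ e).natDegree < n := by
    refine lt_of_le_of_lt Polynomial.natDegree_mul_le ?_
    have := Polynomial.natDegree_X_pow_le (R := K) e
    omega
  rw [secantMatrix_apply, ← Polynomial.coeff_eq_zero_of_natDegree_lt hd,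
    ← sum_eval_div_prod ht hd.le]
  refine Finset.sum_congr rfl fun l _ => ?_
  rw [he, Nat.succ_eq_add_one, pow_succ, Polynomial.eval_mul, Polynomial.eval_pow,
    Polynomial.eval_X]
  field_simp [h0 l]

lemma secantMatrix_apply_inv_of_dvd (ht : Function.Injective t) (h0 : ∀ l, t l ≠ 0)
    (hn : 0 < n) (hφ : φ.natDegree + 2 * m ≤ n) (hdvd : Polynomial.X ∣ φ) (a b : Fin (m + 1)) :
    secantMatrix B t φ m a b (∑ l, (t l)⁻¹ • B l) = 0 := by
  by_cases hab : (a + b : ℕ) = 0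
  · obtain ⟨ψ, rfl⟩ := hdvd
    have hd : ψ.natDegree < n := by
      by_cases hψ : ψ = 0
      · simpa [hψ] using hn
      · rw [Polynomial.natDegree_X_mul hψ] at hφ
        omega
    rw [secantMatrix_apply, ← Polynomial.coeff_eq_zero_of_natDegree_lt hd,
      ← sum_eval_div_prod ht hd.le]
    refine Finset.sum_congr rfl fun l _ => ?_
    rw [hab, pow_zero, Polynomial.eval_mul, Polynomial.eval_X]
    field_simp [h0 l]
  · exact secantMatrix_apply_inv ht h0 hφ a b hab

/-- At least `m + 1` nodes are not roots of `φ`. On a combination of the corresponding basis vectors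
that cancels the weights, the matrix is `Vᵀ * V` with `V` an invertible Vandermonde matrix. -/
lemma detForm_secantMatrix_ne_zero (ht : Function.Injective t) (hφ : φ.natDegree + 2 * m ≤ n)
    (hφ0 : φ ≠ 0) : detForm (secantMatrix B t φ m) ≠ 0 := by
  classical
  have hcard : m + 1 ≤ (Finset.univ.filter fun l => φ.eval (t l) ≠ 0).card := by
    have h1 : (Finset.univ.filter fun l => φ.eval (t l) = 0).card ≤ φ.natDegree := by
      rw [← Finset.card_image_of_injective _ ht]
      refine le_trans (Finset.card_le_card ?_)
        ((Multiset.toFinset_card_le _).trans φ.card_roots')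
      intro x hx
      obtain ⟨l, hl, rfl⟩ := Finset.mem_image.1 hx
      rw [Multiset.mem_toFinset, Polynomial.mem_roots hφ0]
      exact (Finset.mem_filter.1 hl).2
    have h2 := Finset.card_filter_add_card_filter_not (s := (Finset.univ : Finset (Fin (n + 1))))
      (fun l => φ.eval (t l) = 0)
    rw [Finset.card_univ, Fintype.card_fin] at h2
    simp only [ne_eq]
    omega
  obtain ⟨W, hW, hWc⟩ := Finset.exists_subset_card_eq hcard
  let g : Fin (m + 1) → Fin (n + 1) := W.orderEmbOfFin hWc
  have hg : Function.Injective g := (W.orderEmbOfFin hWc).injective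
  have hgW : ∀ a, φ.eval (t (g a)) ≠ 0 := fun a =>
    (Finset.mem_filter.1 (hW (W.orderEmbOfFin_mem hWc a))).2
  have hprod : ∀ l, ∏ j ∈ Finset.univ.erase l, (t l - t j) ≠ 0 := fun l =>
    Finset.prod_ne_zero_iff.2 fun j hj =>
      sub_ne_zero.2 fun h => Finset.ne_of_mem_erase hj (ht h).symm
  intro h0
  have h := eval_detForm (secantMatrix B t φ m) (∑ a, ((∏ j ∈ Finset.univ.erase (g a),
    (t (g a) - t j)) / φ.eval (t (g a))) • B (g a))
  have hV : (Matrix.of fun i j => secantMatrix B t φ m i j (∑ a, ((∏ j ∈ Finset.univ.erase (g a),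
    (t (g a) - t j)) / φ.eval (t (g a))) • B (g a))) =
    (Matrix.vandermonde (t ∘ g)).transpose * Matrix.vandermonde (t ∘ g) := by
    ext i j
    rw [Matrix.vandermonde_transpose_mul_vandermonde, Matrix.of_apply, map_sum]
    refine Finset.sum_congr rfl fun a _ => ?_
    rw [map_smul, secantMatrix_apply_basis]
    have := hprod (g a)
    have := hgW a
    simp only [smul_eq_mul, Function.comp]
    field_simp
  rw [h0, map_zero, hV, Matrix.det_mul, Matrix.det_transpose] at h
  exact mul_self_ne_zero.2 (Matrix.det_vandermonde_ne_zero_iff.2 (ht.comp hg)) h.symm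

/-- The secant variety of a rational normal curve of even degree (`φ = 1`), and the cone over such
a secant variety. -/
theorem HasForm.secant {p : Fin (n + 1) ⊕ Bool → ℙ K (Fin (n + 1) → K)}
    (h0 : ∀ l, t l ≠ 0) (ht : Function.Injective t)
    (hB : ∀ l, ∃ c : K, (p (Sum.inl l)).rep = c • B l)
    (hq : ∃ c : K, (p (Sum.inr true)).rep = c • ∑ l, B l)
    (hq' : ∃ c : K, (p (Sum.inr false)).rep = c • ∑ l, (t l)⁻¹ • B l)
    (hφ : φ.natDegree + 2 * m ≤ n) (hφ0 : φ ≠ 0) {u : Fin (n + 1) ⊕ Bool → ℕ}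
    (huB : ∀ l, u (Sum.inl l) = 0 → φ.eval (t l) = 0)
    (huq : u (Sum.inr true) = 0 → φ.natDegree + 2 * m < n)
    (huq' : u (Sum.inr false) = 0 → 0 < n ∧ Polynomial.X ∣ φ) :
    HasForm p (m + 1) u := by
  refine ⟨detForm (secantMatrix B t φ m), detForm_secantMatrix_ne_zero ht hφ hφ0,
    detForm_isHomogeneous _, fun i => ?_⟩
  have key : ∀ {I : Ideal (MvPolynomial (Fin (n + 1)) K)} {v : ℕ} {f : MvPolynomial (Fin (n + 1)) K},
      f ∈ I ^ m → (v = 0 → f ∈ I ^ (m + 1)) → f ∈ I ^ (m + 1 - v) := by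
    intro I v f h1 h2
    by_cases hv : v = 0
    · simpa [hv] using h2 hv
    · exact Ideal.pow_le_pow_right (by omega) h1
  match i with
  | Sum.inl l =>
    refine key (detForm_mem_of_rank_one (hB l) (k := 0) (v := fun a => t l ^ (a : ℕ))
      fun a b => ?_) fun hu => detForm_mem_of_zero (hB l) fun a b => ?_
    · rw [secantMatrix_apply_basis, secantMatrix_apply_basis]
      simp only [Fin.val_zero, zero_add, pow_add]
      ring
    · rw [secantMatrix_apply_basis, huB l hu]
      simp
  | Sum.inr true =>
    refine key (detForm_mem_of_rank_one hq (k := Fin.last m)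
      (v := fun a => if a = Fin.last m then 1 else 0)
      fun a b => ?_) fun hu => detForm_mem_of_zero hq fun a b => ?_
    · by_cases ha : a = Fin.last m
      · simp [ha]
      · rw [secantMatrix_apply_one ht hφ, if_neg ha, zero_mul]
        refine Polynomial.coeff_eq_zero_of_natDegree_lt
          (lt_of_le_of_lt Polynomial.natDegree_mul_le ?_)
        have := Polynomial.natDegree_X_pow_le (R := K) (a + b : ℕ)
        have : (a : ℕ) ≠ m := fun h => ha (Fin.ext h)
        omega
    · rw [secantMatrix_apply_one ht hφ]
      refine Polynomial.coeff_eq_zero_of_natDegree_lt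
        (lt_of_le_of_lt Polynomial.natDegree_mul_le ?_)
      have := Polynomial.natDegree_X_pow_le (R := K) (a + b : ℕ)
      have := huq hu
      omega
  | Sum.inr false =>
    refine key (detForm_mem_of_rank_one hq' (k := 0)
      (v := fun a => if a = 0 then 1 else 0)
      fun a b => ?_) fun hu => detForm_mem_of_zero hq' fun a b => ?_
    · by_cases ha : a = 0
      · simp [ha]
      · rw [secantMatrix_apply_inv ht h0 hφ, if_neg ha, zero_mul]
        have : (a : ℕ) ≠ 0 := fun h => ha (Fin.ext h)
        omega
    · exact secantMatrix_apply_inv_of_dvd ht h0 (huq' hu).1 hφ (huq' hu).2 a b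

end Secant

/-! ### From degree bounds to Demailly's inequality; forms for at most `n + 2` points. -/

section Waldschmidt
variable {K : Type*} [Field K] {n : ℕ}

lemma mul_mem_symbolicPower {Z : Finset (ℙ K (Fin (n + 1) → K))} {k l : ℕ}
    {f g : MvPolynomial (Fin (n + 1)) K} (hf : f ∈ symbolicPower Z k)
    (hg : g ∈ symbolicPower Z l) : f * g ∈ symbolicPower Z (k + l) := by
  simp only [symbolicPower, Submodule.mem_iInf] at hf hg ⊢
  intro P hP
  rw [pow_add]
  exact Ideal.mul_mem_mul (hf P hP) (hg P hP)

/-- Upper and lower bounds for the initial degrees of the symbolic powers which give Demailly's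
inequality. -/
theorem demailly_of_bounds (hn : 1 ≤ n) {Z : Finset (ℙ K (Fin (n + 1) → K))} {a b : ℕ} (hb : 0 < b)
    (hlow : ∀ (k d : ℕ) (f : MvPolynomial (Fin (n + 1)) K), f ∈ symbolicPower Z k → f ≠ 0 →
      f.IsHomogeneous d → (a + b) * k ≤ b * d)
    (hup : ∀ k : ℕ, ∃ f ∈ symbolicPower Z k, f ≠ 0 ∧ f.IsHomogeneous (k + a * (k + n - 1) / b)) :
    Tendsto (fun k : ℕ => (initialDegree (symbolicPower Z k) : ℝ) / k)
      atTop (𝓝 (waldschmidtConstant Z)) ∧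
    ∀ k : ℕ, 1 ≤ k → waldschmidtConstant Z ≥
        ((initialDegree (symbolicPower Z k) : ℝ) + n - 1) / ((n : ℝ) + k - 1) := by
  have hmem : ∀ k, ∃ f ∈ symbolicPower Z k, f ≠ 0 ∧
      f.IsHomogeneous (initialDegree (symbolicPower Z k)) := fun k =>
    Nat.sInf_mem (s := {j : ℕ | ∃ f ∈ symbolicPower Z k, f ≠ 0 ∧ f.IsHomogeneous j}) ⟨_, hup k⟩
  have hsub : Subadditive fun k => (initialDegree (symbolicPower Z k) : ℝ) := by
    intro k l
    obtain ⟨f, hf, hf0, hfh⟩ := hmem k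
    obtain ⟨g, hg, hg0, hgh⟩ := hmem l
    have : initialDegree (symbolicPower Z (k + l)) ≤
        initialDegree (symbolicPower Z k) + initialDegree (symbolicPower Z l) :=
      Nat.sInf_le ⟨f * g, mul_mem_symbolicPower hf hg, mul_ne_zero hf0 hg0, hfh.mul hgh⟩
    dsimp only
    exact_mod_cast this
  have ht := hsub.tendsto_lim ⟨0, by
    rintro _ ⟨k, rfl⟩
    positivity⟩
  have hw : waldschmidtConstant Z = hsub.lim := ht.limUnder_eq
  have hb' : (0 : ℝ) < b := by exact_mod_cast hb
  have hge : ((a : ℝ) + b) / b ≤ hsub.lim := by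
    refine ge_of_tendsto ht ?_
    filter_upwards [eventually_ge_atTop 1] with k hk
    obtain ⟨f, hf, hf0, hfh⟩ := hmem k
    have h := hlow k _ f hf hf0 hfh
    have hk' : (0 : ℝ) < k := by exact_mod_cast hk
    rw [div_le_div_iff₀ hb' hk', mul_comm _ (b : ℝ)]
    exact_mod_cast h
  rw [hw]
  refine ⟨ht, fun k hk => le_trans ?_ hge⟩
  have h1 : initialDegree (symbolicPower Z k) ≤ k + a * (k + n - 1) / b := Nat.sInf_le (hup k)
  have h2 : b * initialDegree (symbolicPower Z k) ≤ b * k + a * (k + n - 1) := by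
    refine (Nat.mul_le_mul_left b h1).trans ?_
    rw [mul_add]
    exact Nat.add_le_add_left (Nat.mul_div_le _ _) _
  have h3 : (b : ℝ) * initialDegree (symbolicPower Z k) ≤ b * k + a * (k + n - 1) := by
    have : ((k + n - 1 : ℕ) : ℝ) = k + n - 1 := by
      rw [Nat.cast_sub (by omega)]; push_cast; ring
    rw [← this]
    exact_mod_cast h2
  have hn' : (1 : ℝ) ≤ n := by exact_mod_cast hn
  have hk' : (1 : ℝ) ≤ k := by exact_mod_cast hk
  rw [div_le_div_iff₀ (by linarith) hb']
  nlinarith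

lemma HasForm.exists_mem_symbolicPower {ι : Type*} {p : ι → ℙ K (Fin (n + 1) → K)} {d k : ℕ}
    {u : ι → ℕ} (h : HasForm p d u) {Z : Finset (ℙ K (Fin (n + 1) → K))}
    (hZ : ∀ P ∈ Z, ∃ i, p i = P) (hu : ∀ i, k + u i ≤ d) :
    ∃ f ∈ symbolicPower Z k, f ≠ 0 ∧ f.IsHomogeneous d := by
  obtain ⟨f, h0, h1, h2⟩ := h
  refine ⟨f, ?_, h0, h1⟩
  simp only [symbolicPower, Submodule.mem_iInf]
  intro P hP
  obtain ⟨i, rfl⟩ := hZ P hP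
  exact Ideal.pow_le_pow_right (by have := hu i; omega) (h2 i)

/-- Products of hyperplanes through `n` of the points `P i`, `Q`, or through all of these points
but one. -/
theorem hasForm_of_basis {P : Fin (n + 1) → ℙ K (Fin (n + 1) → K)}
    {B : Module.Basis (Fin (n + 1)) K (Fin (n + 1) → K)} (hB : ∀ i, (P i).rep = B i)
    {Q : ℙ K (Fin (n + 1) → K)} {S : Finset (Fin (n + 1))} (hS : ∀ i, i ∈ S ↔ B.repr Q.rep i ≠ 0)
    {k c : ℕ} (hk : 2 * k ≤ (2 * n + 1 - S.card) * c) :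
    HasForm (fun i : Option (Fin (n + 1)) => i.elim Q P) (k + c) fun _ => c := by
  classical
  set p : Option (Fin (n + 1)) → ℙ K (Fin (n + 1) → K) := fun i => i.elim Q P with hp
  have hSc : S.card + Sᶜ.card = n + 1 := by simp [Finset.card_add_card_compl]
  have hS1 : 1 ≤ S.card := by
    rw [Finset.one_le_card]
    by_contra hne
    rw [Finset.not_nonempty_iff_eq_empty] at hne
    apply Q.rep_nonzero
    rw [← B.repr.map_eq_zero_iff]
    ext i
    by_contra h
    simpa [hne] using (hS i).2 h
  have hpair : ∀ e, 2 * e ≤ (S.card + 1) * c →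
      HasForm p e fun i => if ∃ j ∈ Sᶜ, i = some j then 0 else c := by
    intro e he
    -- Cycle through `Q` and the `P j` with `j ∈ S`; any two consecutive points leave `n` others,
    -- which a hyperplane contains.
    let W : Finset (Option (Fin (n + 1))) := Finset.insertNone S
    have hW : W.card = S.card + 1 := Finset.card_insertNone S
    let g : Fin (S.card + 1) → Option (Fin (n + 1)) := fun i => (W.equivFinOfCardEq hW).symm i
    have hg : Function.Injective g :=
      Subtype.val_injective.comp (W.equivFinOfCardEq hW).symm.injective
    have := HasForm.windows (p := p) (δ := 1) (e := cyc g) (l := 2) (fun x =>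
      HasForm.of_card_le (by
        rw [card_occ_cyc_eq_zero hg (by omega)]
        simp)) 0 e
    rw [mul_one, zero_add] at this
    refine this.mono fun i => ?_
    split_ifs with h
    · obtain ⟨j, hj, rfl⟩ := h
      refine (occ_cyc_eq_zero (fun l hl => ?_) _ _).le
      have h1 : g l ∈ W := ((W.equivFinOfCardEq hW).symm l).2
      rw [hl, Finset.some_mem_insertNone] at h1
      exact Finset.mem_compl.1 hj h1
    · exact occ_cyc_le hg (by omega) i
  have hsingle : ∀ e, e ≤ Sᶜ.card * c →
      HasForm p e fun i => if ∃ j ∈ Sᶜ, i = some j then c else 0 := by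
    intro e he
    rcases Nat.eq_zero_or_pos Sᶜ.card with h0 | h0
    · rw [h0, zero_mul, Nat.le_zero] at he
      subst he
      exact HasForm.zero p _
    have : NeZero Sᶜ.card := ⟨h0.ne'⟩
    let g : Fin Sᶜ.card → Option (Fin (n + 1)) := fun i => some (Sᶜ.equivFin.symm i : Fin (n + 1))
    have hg : Function.Injective g :=
      (Option.some_injective _).comp (Subtype.val_injective.comp Sᶜ.equivFin.symm.injective)
    have := HasForm.windows (p := p) (δ := 1) (e := cyc g) (l := 1) (fun x => by
      set j := Sᶜ.equivFin.symm (Fin.ofNat Sᶜ.card x) with hj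
      have hjx : cyc g x = some (j : Fin (n + 1)) := rfl
      -- For `j ∉ S` this coordinate hyperplane contains `Q` and every `P i` except `P j`.
      refine HasForm.of_functional (φ := B.coord j) (fun h => ?_) fun i hi => ?_
      · have := LinearMap.congr_fun h (B j)
        simp at this
      · have hij : cyc g x ≠ i := by
          simpa [occ] using hi
        rw [hjx] at hij
        cases i with
        | none =>
          by_contra h
          exact Finset.mem_compl.1 j.2 ((hS j).2 h)
        | some i =>
          change B.coord j (P i).rep = 0
          rw [hB, Module.Basis.coord_apply, Module.Basis.repr_self, Finsupp.single_apply, if_neg]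
          rintro rfl
          exact hij rfl) 0 e
    rw [mul_one, zero_add] at this
    refine this.mono fun i => ?_
    split_ifs with h
    · exact occ_cyc_le hg (by omega) i
    · refine (occ_cyc_eq_zero (fun l hl => h ⟨_, (Sᶜ.equivFin.symm l).2, hl.symm⟩) _ _).le
  -- Coordinate hyperplanes cost one defect each and are used first; once `c` of each are spent,
  -- pairs supply the remaining degree. The bound `hk` is what this count needs.
  rcases le_total (k + c) (Sᶜ.card * c) with h | h
  · refine (hsingle _ h).mono fun i => ?_
    split_ifs <;> omega
  · have h1 := (hsingle _ le_rfl).mul (hpair (k + c - Sᶜ.card * c) (by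
      have e1 : 2 * n + 1 - S.card = 2 * Sᶜ.card + S.card - 1 := by omega
      obtain ⟨r, hr⟩ := Nat.exists_eq_add_of_le' hS1
      rw [e1, hr, show 2 * Sᶜ.card + (r + 1) - 1 = 2 * Sᶜ.card + r by omega] at hk
      rw [hr]
      have e2 : (2 * Sᶜ.card + r) * c = 2 * (Sᶜ.card * c) + r * c := by ring
      have e3 : (r + 1 + 1) * c = r * c + 2 * c := by ring
      omega))
    rw [Nat.add_sub_cancel' h] at h1
    refine h1.mono fun i => ?_
    split_ifs <;> omega

end Waldschmidt

/-! ### Forms for `n + 3` points on a rational normal curve. -/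

section Curve
variable {K : Type*} [Field K] {n m : ℕ}

/-- `U` secant determinants and `e ≤ m` hyperplanes make up degree `k + c`. Replacing a fraction of
a determinant by hyperplanes costs `m * e` after clearing denominators, whence the term `m * m`. -/
lemma exists_degree_splitting {m n k c : ℕ}
    (h : (2 * m + 3) * k + m * m ≤ (n * (m + 1) + m) * c) :
    ∃ U e, U * (m + 1) + e = k + c ∧ U * (2 * m + 3) + e * 3 ≤ (n + 3) * c := by
  set U := (k + c) / (m + 1) with hU
  set e := (k + c) % (m + 1) with he
  have h1 : U * (m + 1) + e = k + c := Nat.div_add_mod' _ _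
  have h2 : e ≤ m := Nat.le_of_lt_succ (Nat.mod_lt _ m.succ_pos)
  refine ⟨U, e, h1, ?_⟩
  refine Nat.le_of_mul_le_mul_left (c := m + 1) ?_ m.succ_pos
  zify at h h1 h2 ⊢
  have hm : (0 : ℤ) ≤ m := by positivity
  have hc : (c : ℤ) = U * (m + 1) + e - k := by linarith
  nlinarith [mul_le_mul_of_nonneg_left h2 hm]

lemma HasForm.of_windows {ι : Type*} [Fintype ι] [DecidableEq ι]
    (hι : Fintype.card ι = n + 3) {p : ι → ℙ K (Fin (n + 1) → K)} {g : Fin (n + 3) → ι}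
    (hg : Function.Injective g)
    (hw : ∀ x, HasForm p (m + 1) (occ (cyc g) x (x + (2 * m + 3)))) {k c : ℕ}
    (h : (2 * m + 3) * k + m * m ≤ (n * (m + 1) + m) * c) :
    HasForm p (k + c) fun _ => c := by
  obtain ⟨U, e, h1, h2⟩ := exists_degree_splitting h
  have hU := HasForm.windows hw 0 U
  have he := HasForm.windows (p := p) (δ := 1) (e := cyc g) (l := 3) (fun x =>
    HasForm.of_card_le (by rw [card_occ_cyc_eq_zero hg (by omega), hι]; omega))
    (0 + U * (2 * m + 3)) e
  have := hU.mul he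
  rw [mul_one, h1] at this
  refine this.mono fun i => ?_
  rw [occ_add _ (Nat.le_add_right _ _) (Nat.le_add_right _ _)]
  exact occ_cyc_le hg (by omega) i

variable {B : Module.Basis (Fin (n + 1)) K (Fin (n + 1) → K)} {t : Fin (n + 1) → K}
  {p : Fin (n + 1) ⊕ Bool → ℙ K (Fin (n + 1) → K)}

/-- Products of hyperplanes and of cones over secant varieties of the rational normal curve
through the `n + 3` points `p i`. -/
theorem hasForm_of_curve
    (h0 : ∀ l, t l ≠ 0) (ht : Function.Injective t)
    (hB : ∀ l, ∃ c : K, (p (Sum.inl l)).rep = c • B l)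
    (hq : ∃ c : K, (p (Sum.inr true)).rep = c • ∑ l, B l)
    (hq' : ∃ c : K, (p (Sum.inr false)).rep = c • ∑ l, (t l)⁻¹ • B l)
    (hn : n = 2 * m ∨ n = 2 * m + 1) {k c : ℕ}
    (h : (2 * m + 3) * k + m * m ≤ (n * (m + 1) + m) * c) :
    HasForm p (k + c) fun _ => c := by
  have hι : Fintype.card (Fin (n + 1) ⊕ Bool) = n + 3 := by simp
  have hg := (Fintype.equivFinOfCardEq hι).symm.injective
  refine HasForm.of_windows hι hg (fun x => ?_) h
  have hcard := card_occ_cyc_eq_zero hg (x := x) (l := 2 * m + 3) (by omega)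
  set u := occ (cyc (Fintype.equivFinOfCardEq hι).symm) x (x + (2 * m + 3))
  rw [hι] at hcard
  rcases hn with hn | hn
  · have hu : ∀ i, u i ≠ 0 := by
      rw [show n + 3 - (2 * m + 3) = 0 by omega, Finset.card_eq_zero,
        Finset.filter_eq_empty_iff] at hcard
      exact fun i => hcard (Finset.mem_univ i)
    exact HasForm.secant (φ := 1) h0 ht hB hq hq' (by simp [hn]) one_ne_zero
      (fun l hl => absurd hl (hu _)) (fun hl => absurd hl (hu _)) (fun hl => absurd hl (hu _))
  · rw [show n + 3 - (2 * m + 3) = 1 by omega, Finset.card_eq_one] at hcard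
    obtain ⟨i₀, hi₀⟩ := hcard
    have hu : ∀ i, u i = 0 → i = i₀ := fun i hi => by
      rw [← Finset.mem_singleton, ← hi₀]
      simpa using hi
    -- The one point outside the window is the vertex of the cone. The choice of `φ` makes all
    -- matrix entries vanish there: a root at `t l`, a drop in degree at infinity, or a root at
    -- zero.
    match i₀, hu with
    | Sum.inl l, hu =>
      refine HasForm.secant (φ := Polynomial.X - Polynomial.C (t l)) h0 ht hB hq hq'
        (by rw [Polynomial.natDegree_X_sub_C]; omega) (Polynomial.X_sub_C_ne_zero _)
        (fun l' hl' => ?_) (fun hl => ?_) (fun hl => ?_)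
      · have := Sum.inl_injective (hu _ hl')
        simp [this]
      · exact absurd (hu _ hl) (by simp)
      · exact absurd (hu _ hl) (by simp)
    | Sum.inr true, hu =>
      refine HasForm.secant (φ := 1) h0 ht hB hq hq' (by simp; omega) one_ne_zero
        (fun l' hl' => ?_) (fun hl => ?_) (fun hl => ?_)
      · exact absurd (hu _ hl') (by simp)
      · simp; omega
      · exact absurd (hu _ hl) (by simp)
    | Sum.inr false, hu =>
      refine HasForm.secant (φ := Polynomial.X) h0 ht hB hq hq'
        (by rw [Polynomial.natDegree_X]; omega) Polynomial.X_ne_zero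
        (fun l' hl' => ?_) (fun hl => ?_) (fun hl => ⟨by omega, dvd_rfl⟩)
      · exact absurd (hu _ hl') (by simp)
      · exact absurd (hu _ hl) (by simp)

end Curve

/-! ### Coordinates adapted to the points. -/

section Points
variable {K : Type*} [Field K] {n : ℕ} {Z : Finset (ℙ K (Fin (n + 1) → K))}

lemma linearSpan_le_ker {φ : Module.Dual K (Fin (n + 1) → K)} (h : ∀ P ∈ Z, φ P.rep = 0) :
    linearSpan Z ≤ LinearMap.ker φ := by
  refine iSup₂_le fun P hP => ?_
  rw [P.submodule_eq, Submodule.span_singleton_le_iff_mem]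
  exact h P hP

lemma exists_basis_of_linearSpan_eq_top (h : linearSpan Z = ⊤) :
    ∃ (P : Fin (n + 1) → ℙ K (Fin (n + 1) → K))
      (B : Module.Basis (Fin (n + 1)) K (Fin (n + 1) → K)),
      Function.Injective P ∧ (∀ i, P i ∈ Z) ∧ ∀ i, (P i).rep = B i := by
  obtain ⟨κ, a, ha, hsp, hli⟩ := exists_linearIndependent' K (fun P : Z => P.1.rep)
  have htop : ⊤ ≤ Submodule.span K (Set.range ((fun P : Z => P.1.rep) ∘ a)) := by
    rw [hsp, ← h]
    refine iSup₂_le fun P hP => ?_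
    rw [P.submodule_eq, Submodule.span_singleton_le_iff_mem]
    exact Submodule.subset_span ⟨⟨P, hP⟩, rfl⟩
  let B := Module.Basis.mk hli htop
  let e : κ ≃ Fin (n + 1) := B.indexEquiv (Pi.basisFun K (Fin (n + 1)))
  refine ⟨fun i => (a (e.symm i)).1, B.reindex e, fun i j hij => ?_, fun i => (a _).2, fun i => ?_⟩
  · exact e.symm.injective (ha (Subtype.ext hij))
  · simp [B]

lemma LinearlyGeneral.eq_zero (h : LinearlyGeneral Z) {S : Finset (ℙ K (Fin (n + 1) → K))}
    (hS : S ⊆ Z) (hc : S.card = n + 1) {φ : Module.Dual K (Fin (n + 1) → K)}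
    (hφ : ∀ P ∈ S, φ P.rep = 0) : φ = 0 := by
  have h1 := h S hS hc.le
  have h2 : linearSpan S = ⊤ := Submodule.eq_top_of_finrank_eq (by simp [h1, hc])
  have h3 := linearSpan_le_ker hφ
  rw [h2, top_le_iff] at h3
  exact LinearMap.ker_eq_top.1 h3

/-- Coordinates in which `n + 3` points in linearly general position lie on a rational normal
curve in standard form. -/
theorem LinearlyGeneral.exists_coordinates (h : LinearlyGeneral Z) (hspan : linearSpan Z = ⊤)
    (hc : Z.card = n + 3) :
    ∃ (p : Fin (n + 1) ⊕ Bool → ℙ K (Fin (n + 1) → K))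
      (B : Module.Basis (Fin (n + 1)) K (Fin (n + 1) → K)) (t : Fin (n + 1) → K),
      (∀ P, P ∈ Z ↔ ∃ i, p i = P) ∧ (∀ l, t l ≠ 0) ∧ Function.Injective t ∧
      (∀ l, ∃ c : K, c ≠ 0 ∧ (p (Sum.inl l)).rep = c • B l) ∧
      (p (Sum.inr true)).rep = ∑ l, B l ∧
      (p (Sum.inr false)).rep = ∑ l, (t l)⁻¹ • B l := by
  classical
  obtain ⟨P, B, hP, hPZ, hB⟩ := exists_basis_of_linearSpan_eq_top hspan
  have hsub : Finset.univ.image P ⊆ Z := Finset.image_subset_iff.2 fun i _ => hPZ i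
  have hcI : (Finset.univ.image P).card = n + 1 := by
    rw [Finset.card_image_of_injective _ hP]; simp
  obtain ⟨Q, Q', hQ, hZQ⟩ := Finset.card_eq_two.1
    (show (Z \ Finset.univ.image P).card = 2 by rw [Finset.card_sdiff_of_subset hsub]; omega)
  have hmem : ∀ R, R ∈ Z ↔ (∃ i, P i = R) ∨ R = Q ∨ R = Q' := by
    intro R
    have h1 : R ∈ Z \ Finset.univ.image P ↔ R = Q ∨ R = Q' := by rw [hZQ]; simp
    rw [← h1, Finset.mem_sdiff, Finset.mem_image]
    have : (∃ i, P i = R) → R ∈ Z := fun ⟨i, hi⟩ => hi ▸ hPZ i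
    simp only [Finset.mem_univ, true_and]
    tauto
  have hne : ∀ R, R = Q ∨ R = Q' → ∀ i, P i ≠ R := by
    intro R hR i hi
    have h1 : R ∈ Z \ Finset.univ.image P := by rw [hZQ]; simpa using hR
    exact (Finset.mem_sdiff.1 h1).2 (Finset.mem_image.2 ⟨i, Finset.mem_univ _, hi⟩)
  -- A vanishing coordinate would put `R` and `n` of the `P j` on a hyperplane.
  have hcoord : ∀ R, R = Q ∨ R = Q' → ∀ i, B.repr R.rep i ≠ 0 := by
    intro R hR i hi
    have := h.eq_zero (S := insert R ((Finset.univ.erase i).image P))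
      (φ := B.coord i) ?_ ?_ ?_
    · have := LinearMap.congr_fun this (B i)
      simp at this
    · refine Finset.insert_subset ((hmem R).2 (Or.inr hR))
        (Finset.image_subset_iff.2 fun j _ => hPZ j)
    · rw [Finset.card_insert_of_notMem, Finset.card_image_of_injective _ hP,
        Finset.card_erase_of_mem (Finset.mem_univ i)]
      · simp
      · intro hR'
        obtain ⟨j, -, hj⟩ := Finset.mem_image.1 hR'
        exact hne R hR j hj
    · intro R' hR'
      rcases Finset.mem_insert.1 hR' with rfl | hR'
      · simpa using hi
      · obtain ⟨j, hj, rfl⟩ := Finset.mem_image.1 hR'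
        rw [hB]
        simp [Finset.ne_of_mem_erase hj]
  have hq := hcoord Q (Or.inl rfl)
  have hq' := hcoord Q' (Or.inr rfl)
  let B' := B.isUnitSMul fun i => (hq i).isUnit
  have hB' : ∀ i, B' i = B.repr Q.rep i • B i := fun i => B.isUnitSMul_apply _ i
  refine ⟨Sum.elim P fun s => if s then Q else Q', B',
    fun i => B.repr Q.rep i / B.repr Q'.rep i, fun R => ?_, fun l => div_ne_zero (hq l) (hq' l),
    fun i j hij => ?_, fun l => ⟨(B.repr Q.rep l)⁻¹, inv_ne_zero (hq l), ?_⟩, ?_, ?_⟩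
  · rw [hmem, or_comm (a := R = Q)]
    simp [eq_comm]
  · by_contra hne'
    dsimp only at hij
    rw [div_eq_div_iff (hq' i) (hq' j)] at hij
    -- If two parameters coincide, this functional vanishes at `Q`, `Q'` and the `n - 1` remaining
    -- `P l`, which contradicts general position.
    have := h.eq_zero (S := insert Q (insert Q' (((Finset.univ.erase i).erase j).image P)))
      (φ := B.repr Q.rep j • B.coord i - B.repr Q.rep i • B.coord j) ?_ ?_ ?_
    · have := LinearMap.congr_fun this (B i)
      simp [Ne.symm hne', hq j] at this
    · refine Finset.insert_subset ((hmem _).2 (by simp)) (Finset.insert_subset ((hmem _).2 (by simp))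
        (Finset.image_subset_iff.2 fun j _ => hPZ j))
    · rw [Finset.card_insert_of_notMem, Finset.card_insert_of_notMem,
        Finset.card_image_of_injective _ hP, Finset.card_erase_of_mem,
        Finset.card_erase_of_mem (Finset.mem_univ i), Finset.card_univ, Fintype.card_fin]
      · have : Nontrivial (Fin (n + 1)) := ⟨i, j, hne'⟩
        have := Fin.nontrivial_iff_two_le.1 this
        omega
      · exact Finset.mem_erase.2 ⟨Ne.symm hne', Finset.mem_univ _⟩
      · intro hR'
        obtain ⟨j, -, hj⟩ := Finset.mem_image.1 hR'
        exact hne _ (Or.inr rfl) j hj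
      · intro hR'
        rcases Finset.mem_insert.1 hR' with h1 | h1
        · exact hQ h1
        obtain ⟨j, -, hj⟩ := Finset.mem_image.1 h1
        exact hne _ (Or.inl rfl) j hj
    · intro R' hR'
      rcases Finset.mem_insert.1 hR' with rfl | hR'
      · simp [mul_comm]
      rcases Finset.mem_insert.1 hR' with rfl | hR'
      · simp only [LinearMap.sub_apply, LinearMap.smul_apply, Module.Basis.coord_apply, smul_eq_mul]
        linear_combination -hij
      · obtain ⟨l, hl, rfl⟩ := Finset.mem_image.1 hR'
        rw [hB]
        have h1 := Finset.ne_of_mem_erase hl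
        have h2 := Finset.ne_of_mem_erase (Finset.mem_of_mem_erase hl)
        simp [h1, h2]
  · simp only [Sum.elim_inl]
    rw [hB, hB', smul_smul, inv_mul_cancel₀ (hq l), one_smul]
  · simp only [Sum.elim_inr, if_true, hB']
    exact (B.sum_repr _).symm
  · simp only [Sum.elim_inr, hB', smul_smul]
    conv_lhs => rw [← B.sum_repr (if false = true then Q else Q').rep]
    refine Finset.sum_congr rfl fun l _ => ?_
    have := hq l
    simp [inv_div, div_mul_cancel₀ _ this]

end Points

/-! ### The constants `a`, `b` in each case. -/

section Main
variable {K : Type*} [Field K] {n : ℕ} {Z : Finset (ℙ K (Fin (n + 1) → K))}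

theorem demailly_of_card_le (hn : 1 ≤ n) (hspan : linearSpan Z = ⊤) (hcard : Z.card ≤ n + 2) :
    Tendsto (fun k : ℕ => (initialDegree (symbolicPower Z k) : ℝ) / k)
      atTop (𝓝 (waldschmidtConstant Z)) ∧
    ∀ k : ℕ, 1 ≤ k → waldschmidtConstant Z ≥
        ((initialDegree (symbolicPower Z k) : ℝ) + n - 1) / ((n : ℝ) + k - 1) := by
  classical
  obtain ⟨P, B, hP, hPZ, hB⟩ := exists_basis_of_linearSpan_eq_top hspan
  have hsub : Finset.univ.image P ⊆ Z := Finset.image_subset_iff.2 fun i _ => hPZ i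
  have hcI : (Finset.univ.image P).card = n + 1 := by
    rw [Finset.card_image_of_injective _ hP]; simp
  have hsd : (Z \ Finset.univ.image P).card ≤ 1 := by
    rw [Finset.card_sdiff_of_subset hsub]; omega
  obtain ⟨Q, hQZ, hQ⟩ : ∃ Q ∈ Z, ∀ R ∈ Z, (∃ i, P i = R) ∨ R = Q := by
    have hR : ∀ R ∈ Z, (∃ i, P i = R) ∨ R ∈ Z \ Finset.univ.image P := fun R hR => by
      rw [Finset.mem_sdiff, Finset.mem_image]
      simp only [Finset.mem_univ, true_and]
      tauto
    rcases Finset.eq_empty_or_nonempty (Z \ Finset.univ.image P) with h | ⟨Q, hQ⟩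
    -- For `n + 1` points a basis point is repeated, with support of size one.
    · refine ⟨P 0, hPZ 0, fun R hRZ => (hR R hRZ).imp_right fun h' => ?_⟩
      rw [h] at h'
      exact absurd h' (Finset.notMem_empty R)
    · exact ⟨Q, (Finset.mem_sdiff.1 hQ).1, fun R hRZ => (hR R hRZ).imp_right fun h' =>
        Finset.card_le_one.1 hsd R h' Q hQ⟩
  let S : Finset (Fin (n + 1)) := {i | B.repr Q.rep i ≠ 0}
  have hS : ∀ i, i ∈ S ↔ B.repr Q.rep i ≠ 0 := fun i => by simp [S]
  have hSn : S.card ≤ n + 1 := by simpa using Finset.card_le_univ S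
  have hS1 : 1 ≤ S.card := by
    rw [Finset.one_le_card]
    by_contra hne
    rw [Finset.not_nonempty_iff_eq_empty] at hne
    apply Q.rep_nonzero
    rw [← B.repr.map_eq_zero_iff]
    ext i
    by_contra h
    simpa [hne] using (hS i).2 h
  refine demailly_of_bounds hn (a := 2) (b := 2 * n + 1 - S.card) (by omega)
    (fun k d f hf h0 hfh => ?_) fun k => ?_
  · obtain ⟨h1, h2⟩ := degree_bound_of_basis B hfh h0
      (fun i => by simpa [hB] using mem_maxIdeal_pow_of_mem_symbolicPower hf (hPZ i) 1)
      (by simpa using mem_maxIdeal_pow_of_mem_symbolicPower hf hQZ 1) hS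
    obtain ⟨e, rfl⟩ := Nat.exists_eq_add_of_le h1
    rw [show 2 * (n + 1) - S.card = (2 * n + 1 - S.card) + 1 by omega,
      Nat.add_sub_cancel_left] at h2
    nlinarith
  · set b := 2 * n + 1 - S.card with hb
    refine (hasForm_of_basis hB hS (k := k) (c := 2 * (k + n - 1) / b) ?_).exists_mem_symbolicPower
      (fun R hR => ?_) fun i => le_rfl
    · have h1 := Nat.div_add_mod (2 * (k + n - 1)) b
      have h2 := Nat.mod_lt (2 * (k + n - 1)) (show 0 < b by omega)
      rw [← hb]
      -- Rounding down loses at most `b - 1`, which is harmless if `b ≤ 2 * n - 1`. For `b = 2 * n`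
      -- the remainder is even, hence at most `b - 2`.
      rcases hS1.eq_or_lt with hs | hs
      · rw [show b = 2 * n by omega] at h1 h2 ⊢
        rw [mul_assoc] at h1 ⊢
        omega
      · omega
    · rcases hQ R hR with ⟨i, rfl⟩ | rfl
      · exact ⟨some i, rfl⟩
      · exact ⟨none, rfl⟩

theorem demailly_of_linearlyGeneral (hn : 1 ≤ n) (hspan : linearSpan Z = ⊤)
    (hcard : Z.card = n + 3) (hgen : LinearlyGeneral Z) :
    Tendsto (fun k : ℕ => (initialDegree (symbolicPower Z k) : ℝ) / k)
      atTop (𝓝 (waldschmidtConstant Z)) ∧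
    ∀ k : ℕ, 1 ≤ k → waldschmidtConstant Z ≥
        ((initialDegree (symbolicPower Z k) : ℝ) + n - 1) / ((n : ℝ) + k - 1) := by
  obtain ⟨p, B, t, hZ, ht0, ht, hB, hq, hq'⟩ := hgen.exists_coordinates hspan hcard
  have hup : ∀ {m k c : ℕ}, (n = 2 * m ∨ n = 2 * m + 1) →
      (2 * m + 3) * k + m * m ≤ (n * (m + 1) + m) * c →
      ∃ f ∈ symbolicPower Z k, f ≠ 0 ∧ f.IsHomogeneous (k + c) := fun hm h =>
    (hasForm_of_curve ht0 ht (fun l => (hB l).imp fun c hc => hc.2) ⟨1, by rw [hq, one_smul]⟩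
      ⟨1, by rw [hq', one_smul]⟩ hm h).exists_mem_symbolicPower
      (fun R hR => (hZ R).1 hR) fun i => le_rfl
  have hpZ : ∀ i, p i ∈ Z := fun i => (hZ _).2 ⟨i, rfl⟩
  have hmB : ∀ {k : ℕ} {f : MvPolynomial (Fin (n + 1)) K}, f ∈ symbolicPower Z k →
      ∀ l, f ∈ maxIdeal (B l) ^ k := fun hf l => by
    obtain ⟨c, hc, hcl⟩ := hB l
    have := mem_maxIdeal_pow_of_mem_symbolicPower hf (hpZ (Sum.inl l)) c⁻¹
    rwa [hcl, smul_smul, inv_mul_cancel₀ hc, one_smul] at this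
  have hmq : ∀ {k : ℕ} {f : MvPolynomial (Fin (n + 1)) K}, f ∈ symbolicPower Z k →
      f ∈ maxIdeal (∑ l, B l) ^ k := fun hf => by
    simpa [hq] using mem_maxIdeal_pow_of_mem_symbolicPower hf (hpZ (Sum.inr true)) 1
  have hmq' : ∀ {k : ℕ} {f : MvPolynomial (Fin (n + 1)) K}, f ∈ symbolicPower Z k →
      f ∈ maxIdeal (∑ l, (t l)⁻¹ • B l) ^ k := fun hf => by
    simpa [hq'] using mem_maxIdeal_pow_of_mem_symbolicPower hf (hpZ (Sum.inr false)) 1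
  have hbound : ∀ {k d : ℕ} {f : MvPolynomial (Fin (n + 1)) K}, f ∈ symbolicPower Z k → f ≠ 0 →
      f.IsHomogeneous d → k ≤ d ∧ k + d ≤ (n + 1) * (d - k) := fun hf h0 hfh => by
    have := degree_bound_of_basis B hfh h0 (hmB hf) (hmq hf) (S := Finset.univ)
      (fun i => by simp [Finsupp.single_apply])
    rwa [Finset.card_univ, Fintype.card_fin, show 2 * (n + 1) - (n + 1) = n + 1 by omega] at this
  rcases Nat.even_or_odd' n with ⟨m, hm | hm⟩
  · refine demailly_of_bounds hn (a := 2) (b := n) (by omega)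
      (fun k d f hf h0 hfh => ?_) fun k => hup (Or.inl hm) ?_
    · obtain ⟨h1, h2⟩ := hbound hf h0 hfh
      obtain ⟨e, rfl⟩ := Nat.exists_eq_add_of_le h1
      rw [Nat.add_sub_cancel_left] at h2
      nlinarith
    · have h1 := Nat.div_add_mod (2 * (k + n - 1)) n
      have h2 := Nat.mod_lt (2 * (k + n - 1)) (show 0 < n by omega)
      generalize 2 * (k + n - 1) / n = c at *
      generalize 2 * (k + n - 1) % n = r at *
      -- Since `n = 2 * m`, the remainder is even and at most `n - 2`.
      have h3 : k + m ≤ m * c := by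
        rw [hm, mul_assoc] at h1
        omega
      rw [hm]
      nlinarith
  · refine demailly_of_bounds hn (a := n + 2) (b := n * (m + 1) + m) (by positivity)
      (fun k d f hf h0 hfh => ?_) fun k => hup (Or.inr hm) ?_
    · obtain ⟨h1, h2⟩ := hbound hf h0 hfh
      have h3 := degree_bound_of_odd B (T := m + 1) (by omega) hfh h0 (hmB hf) ht0 ht (hmq hf)
        (hmq' hf)
      obtain ⟨e, rfl⟩ := Nat.exists_eq_add_of_le h1
      rw [Nat.add_sub_cancel_left] at h2 h3
      have h4 : (n + 2) * k ≤ (n * (m + 1) + m) * e := by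
        rw [show n + 1 = 2 * (m + 1) by omega] at h2
        obtain ⟨D, hD⟩ := Nat.exists_eq_add_of_le (show k + e ≤ 2 * (m + 1) * e by omega)
        rw [hD, Nat.add_sub_cancel_left] at h3
        rw [hm]
        -- For `2 * k ≤ D` the multiplicity along the curve truncates to zero, but then the
        -- inequality on `D` is already strong enough; otherwise the secant bound gives the claim.
        rcases le_total (2 * k) D with h | h
        · have h5 : 3 * k ≤ (2 * m + 1) * e := by nlinarith
          nlinarith [Nat.mul_le_mul_left (2 * m + 3) h5]
        · obtain ⟨μ, hμ⟩ := Nat.exists_eq_add_of_le h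
          rw [hμ, Nat.add_sub_cancel_left] at h3
          nlinarith
      nlinarith
    · have h1 := Nat.div_add_mod ((n + 2) * (k + n - 1)) (n * (m + 1) + m)
      have h2 := Nat.mod_lt ((n + 2) * (k + n - 1))
        (show 0 < n * (m + 1) + m by positivity)
      generalize (n + 2) * (k + n - 1) / (n * (m + 1) + m) = c at *
      rw [show k + n - 1 = k + 2 * m by omega] at h1 h2
      rw [hm] at h1 h2 ⊢
      nlinarith

end Main

end FatPoints

theorem corollary5p6 {K : Type*} [Field K] {n : ℕ} (hn : 1 ≤ n)
    (Z : Finset (ℙ K (Fin (n + 1) → K)))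
    (hspan : FatPoints.linearSpan Z = ⊤)
    (hcard : Z.card ≤ n + 3)
    (hgen : Z.card = n + 3 → FatPoints.LinearlyGeneral Z) :
    Tendsto (fun k : ℕ => (FatPoints.initialDegree (FatPoints.symbolicPower Z k) : ℝ) / k)
      atTop (𝓝 (FatPoints.waldschmidtConstant Z)) ∧
    ∀ k : ℕ, 1 ≤ k →
      (Z.card = n + 3 → Odd n →
        ((n : ℝ) ^ 2 + n + 1) * ((n : ℝ) ^ 2 + 2 * n - 1) / (2 * ((n : ℝ) + 2)) ≤ (k : ℝ)) →
      FatPoints.waldschmidtConstant Z ≥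
        ((FatPoints.initialDegree (FatPoints.symbolicPower Z k) : ℝ) + n - 1) / ((n : ℝ) + k - 1) := by
  rcases hcard.lt_or_eq with h | h
  · have := FatPoints.demailly_of_card_le hn hspan (Nat.le_of_lt_succ h)
    exact ⟨this.1, fun k hk _ => this.2 k hk⟩
  · have := FatPoints.demailly_of_linearlyGeneral hn hspan h (hgen h)
    exact ⟨this.1, fun k hk _ => this.2 k hk⟩
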